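/- Let $V$ be an $n$-dimensional complex vector space with a Hermitian inner product, and let $W\subseteq U(V)$ be a finite group generated by unitary reflections (unitary transformations whose fixed space is a hyperplane). Let $x_1,\dots,x_n$ be the basis of $V^*$ dual to an orthonormal basis of $V$, let $S=S(V^*)=\mathbb C[x_1,\dots,x_n]$, on which $W$ acts by $(w\cdot f)(v)=f(w^{-1}v)$, and let $R=S^W$. A system of basic invariants is a family of $n$ algebraically independent homogeneous polynomials $h_1,\dots,h_n$ that generate the algebra $R$. For $f=\sum_a c_a x^a\in S$ let $f^*=\sum_a\overline{c_a}\,\partial^a$ be the associated differential operator on $S$, and put $\langle f,g\rangle=(f^*g)|_{x=0}$, a Hermitian inner product on $S$. A system of basic invariants $f_1,\dots,f_n$ is called canonical if $f_i^*f_j=\delta_{ij}$ for all $i,j=1,\dots,n$. For every reflecting hyperplane $H$ of $W$ (the fixed space of a reflection in $W$) let $e_H$ be the order of the cyclic group of all elements of $W$ that fix $H$ pointwise, choose $L_H\in V^*$ with $\ker L_H=H$, and put $\Delta=\prod_H L_H^{e_H-1}$ and $\phi(f)=(f^*\Delta)^*\Delta$ for $f\in S$. Theorem. Let $h_1,\dots,h_n$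 be an arbitrary system of basic invariants of $W$. Then the Gram–Schmidt orthonormalization, with respect to $\langle\cdot,\cdot\rangle$, of the polynomials $$\sum_{j=1}^n x_j\,\phi(\partial_j h_i)\qquad(i=1,\dots,n)$$ is a canonical system of basic invariants of $W$. -/

import Mathlib

namespace CanonicalInvariants

open MvPolynomial

noncomputable section

/-! ### Polynomials as differential operators -/

/-- The differential operator `∂₁^{a₁} ⋯ ∂ₙ^{aₙ}` on `ℂ[x₁, …, xₙ]`. -/
def diffMonomial {n : ℕ} (a : Fin n →₀ ℕ) : Module.End ℂ (MvPolynomial (Fin n) ℂ) :=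
  ((List.finRange n).map fun i => (pderiv i).toLinearMap ^ a i).prod

/-- The differential operator `f^* = ∑ₐ conj (cₐ) ∂^a` attached to `f = ∑ₐ cₐ x^a`. -/
def starOp {n : ℕ} (f : MvPolynomial (Fin n) ℂ) : Module.End ℂ (MvPolynomial (Fin n) ℂ) :=
  ∑ a ∈ f.support, starRingEnd ℂ (f.coeff a) • diffMonomial a

/-- The pairing `⟨f, g⟩ = (f^* g)(0)`. -/
def pairing {n : ℕ} (f g : MvPolynomial (Fin n) ℂ) : ℂ :=
  eval 0 (starOp f g)

theorem coeff_pderiv_pow_aux {n : ℕ} (i : Fin n) (k : ℕ) (m : Fin n →₀ ℕ)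
    (g : MvPolynomial (Fin n) ℂ) :
    coeff m (((pderiv i).toLinearMap ^ k : Module.End ℂ (MvPolynomial (Fin n) ℂ)) g) =
      ((m i + 1).ascFactorial k : ℂ) * coeff (m + Finsupp.single i k) g := by
  induction k generalizing m with
  | zero => simp
  | succ k ih =>
    rw [pow_succ']
    change coeff m (pderiv i _) = _
    rw [coeff_pderiv, ih, add_assoc, ← Finsupp.single_add, mul_comm, ← mul_assoc]
    congr 1
    · have := Nat.succ_ascFactorial (m i + 1) k
      have h2 : (m i + 1) * (m i + 1 + 1).ascFactorial k = (m i + 1).ascFactorial (k + 1) := by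
        rw [Nat.ascFactorial_succ]; simpa using this
      rw [← h2]
      simp
    · rw [add_comm 1 k]

theorem coeff_list_aux {n : ℕ} (a : Fin n →₀ ℕ) (l : List (Fin n)) (hl : l.Nodup)
    (m : Fin n →₀ ℕ) (hm : ∀ i ∈ l, m i = 0) (g : MvPolynomial (Fin n) ℂ) :
    coeff m ((l.map fun i =>
      ((pderiv i).toLinearMap ^ a i : Module.End ℂ (MvPolynomial (Fin n) ℂ))).prod g) =
      (l.map fun i => ((a i).factorial : ℂ)).prod *
        coeff (m + (l.map fun i => Finsupp.single i (a i)).sum) g := by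
  classical
  induction l generalizing m with
  | nil => simp
  | cons i l ih =>
    rw [List.nodup_cons] at hl
    simp only [List.map_cons, List.prod_cons, List.sum_cons, Module.End.mul_apply]
    rw [coeff_pderiv_pow_aux, ih hl.2, hm i (by simp)]
    · simp only [zero_add, Nat.one_ascFactorial]
      rw [mul_assoc, add_assoc]
    · intro j hj
      have hij : i ≠ j := fun h => hl.1 (h ▸ hj)
      simp [hm j (by simp [hj]), hij]

theorem eval_diffMonomial {n : ℕ} (a : Fin n →₀ ℕ) (g : MvPolynomial (Fin n) ℂ) :
    eval 0 (diffMonomial a g) = (∏ i, ((a i).factorial : ℂ)) * coeff a g := by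
  rw [show eval (0 : Fin n → ℂ) = constantCoeff from eval_zero, constantCoeff_eq, diffMonomial,
    coeff_list_aux a _ (List.nodup_finRange n) 0 (by simp)]
  simp only [zero_add, ← List.ofFn_eq_map, List.prod_ofFn, List.sum_ofFn]
  congr 2
  ext j
  simp [Finsupp.single_apply]

theorem pairing_eq {n : ℕ} (f g : MvPolynomial (Fin n) ℂ) (s : Finset (Fin n →₀ ℕ))
    (hs : f.support ⊆ s) :
    pairing f g =
      ∑ a ∈ s, starRingEnd ℂ (coeff a f) * ((∏ i, ((a i).factorial : ℂ)) * coeff a g) := by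
  rw [pairing, starOp, ← Finset.sum_subset hs]
  · simp only [LinearMap.sum_apply, LinearMap.smul_apply, map_sum, smul_eval, eval_diffMonomial]
  · intro a _ ha
    simp [notMem_support_iff.mp ha]

/-- `⟨f, g⟩ = (f^* g)(0)` is a positive definite Hermitian form. -/
@[reducible]
def pairingCore (n : ℕ) : InnerProductSpace.Core ℂ (MvPolynomial (Fin n) ℂ) where
  inner := pairing
  conj_inner_symm f g := by
    classical
    change starRingEnd ℂ (pairing g f) = pairing f g
    rw [pairing_eq g f _ Finset.subset_union_right, pairing_eq f g _ Finset.subset_union_left]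
    simp only [map_sum, map_mul, map_prod, map_natCast, Complex.conj_conj]
    exact Finset.sum_congr rfl fun a _ => by ring
  re_inner_nonneg f := by
    rw [pairing_eq f f _ subset_rfl, map_sum]
    refine Finset.sum_nonneg fun a _ => ?_
    have : starRingEnd ℂ (coeff a f) * ((∏ i, ((a i).factorial : ℂ)) * coeff a f) =
        (((∏ i, ((a i).factorial : ℝ)) * Complex.normSq (coeff a f) : ℝ) : ℂ) := by
      push_cast
      rw [Complex.normSq_eq_conj_mul_self]; ring
    rw [this]
    simp only [RCLike.re_to_complex, Complex.ofReal_re]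
    exact mul_nonneg (Finset.prod_nonneg fun i _ => Nat.cast_nonneg _) (Complex.normSq_nonneg _)
  add_left f g h := by
    classical
    change pairing (f + g) h = pairing f h + pairing g h
    rw [pairing_eq (f + g) h _ support_add, pairing_eq f h _ Finset.subset_union_left,
      pairing_eq g h _ Finset.subset_union_right, ← Finset.sum_add_distrib]
    exact Finset.sum_congr rfl fun a _ => by simp; ring
  smul_left f g r := by
    change pairing (r • f) g = starRingEnd ℂ r * pairing f g
    rw [pairing_eq (r • f) g _ support_smul, pairing_eq f g _ subset_rfl, Finset.mul_sum]
    exact Finset.sum_congr rfl fun a _ => by simp; ring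
  definite f hf := by
    change pairing f f = 0 at hf
    have key : pairing f f = ((∑ a ∈ f.support,
        (∏ i, ((a i).factorial : ℝ)) * Complex.normSq (coeff a f) : ℝ) : ℂ) := by
      rw [pairing_eq f f _ subset_rfl]
      push_cast
      refine Finset.sum_congr rfl fun a _ => ?_
      rw [Complex.normSq_eq_conj_mul_self]; ring
    rw [key, Complex.ofReal_eq_zero, Finset.sum_eq_zero_iff_of_nonneg] at hf
    · ext a
      by_contra hne
      have h1 := hf a (mem_support_iff.mpr hne)
      have h2 : (∏ i, ((a i).factorial : ℝ)) ≠ 0 :=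
        Finset.prod_ne_zero_iff.mpr fun i _ => by exact_mod_cast Nat.factorial_ne_zero _
      rcases mul_eq_zero.mp h1 with h | h
      · exact h2 h
      · exact hne (Complex.normSq_eq_zero.mp h)
    · intro a _
      exact mul_nonneg (Finset.prod_nonneg fun i _ => Nat.cast_nonneg _) (Complex.normSq_nonneg _)

/-- Gram–Schmidt orthonormalization of a finite sequence of polynomials with respect to
`⟨f, g⟩ = (f^* g)(0)`. -/
def gramSchmidtPoly {n : ℕ} (g : Fin n → MvPolynomial (Fin n) ℂ) :
    Fin n → MvPolynomial (Fin n) ℂ :=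
  letI : NormedAddCommGroup (MvPolynomial (Fin n) ℂ) := (pairingCore n).toNormedAddCommGroup
  letI : InnerProductSpace ℂ (MvPolynomial (Fin n) ℂ) := InnerProductSpace.ofCore
    (pairingCore n).toCore
  InnerProductSpace.gramSchmidtNormed ℂ g

/-! ### Unitary reflection groups -/

section Group

variable {V : Type*} [NormedAddCommGroup V] [InnerProductSpace ℂ V]

/-- The space of vectors fixed by a unitary transformation. -/
def fixedSpace (s : V ≃ₗᵢ[ℂ] V) : Submodule ℂ V where
  carrier := {v | s v = v}
  add_mem' {v w} hv hw := by
    simp only [Set.mem_ofPred_eq] at hv hw ⊢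
    rw [map_add, hv, hw]
  zero_mem' := map_zero s
  smul_mem' c v hv := by
    simp only [Set.mem_ofPred_eq] at hv ⊢
    rw [map_smul, hv]

/-- A unitary reflection of a finite dimensional space: its fixed space is a hyperplane. -/
def IsUnitaryReflection (s : V ≃ₗᵢ[ℂ] V) : Prop :=
  Module.finrank ℂ (fixedSpace s) + 1 = Module.finrank ℂ V

/-- `W` is generated by the reflections it contains. -/
def IsReflectionGroup (W : Subgroup (V ≃ₗᵢ[ℂ] V)) : Prop :=
  Subgroup.closure {s | s ∈ W ∧ IsUnitaryReflection s} = W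

/-- The reflecting hyperplanes of `W`. -/
def reflectingHyperplanes (W : Subgroup (V ≃ₗᵢ[ℂ] V)) : Set (Submodule ℂ V) :=
  fixedSpace '' {s | s ∈ W ∧ IsUnitaryReflection s}

theorem finite_reflectingHyperplanes (W : Subgroup (V ≃ₗᵢ[ℂ] V)) [Finite W] :
    (reflectingHyperplanes W).Finite :=
  ((Set.toFinite (W : Set (V ≃ₗᵢ[ℂ] V))).subset fun _ hs => hs.1).image _

/-- The subgroup of `W` fixing `H` pointwise. If `H` is a reflecting hyperplane and `W` is finite
it is the cyclic group generated by a reflection `s_H` along `H`. -/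
def pointwiseStabilizer (W : Subgroup (V ≃ₗᵢ[ℂ] V)) (H : Submodule ℂ V) :
    Subgroup (V ≃ₗᵢ[ℂ] V) where
  carrier := {w | w ∈ W ∧ ∀ v ∈ H, w v = v}
  mul_mem' {s t} hs ht := ⟨W.mul_mem hs.1 ht.1, fun v hv => by
    change s (t v) = v
    rw [ht.2 v hv, hs.2 v hv]⟩
  one_mem' := ⟨W.one_mem, fun _ _ => rfl⟩
  inv_mem' {s} hs := ⟨W.inv_mem hs.1, fun v hv => by
    change s.symm v = v
    rw [LinearIsometryEquiv.symm_apply_eq, hs.2 v hv]⟩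

variable {n : ℕ} (b : OrthonormalBasis (Fin n) ℂ V)

/-- A linear form `ℓ ∈ V^*` as a polynomial in the coordinates `x₁, …, xₙ ∈ V^*` with respect to
the orthonormal basis `b` of `V`. -/
def linearForm (ℓ : Module.Dual ℂ V) : MvPolynomial (Fin n) ℂ :=
  ∑ j, C (ℓ (b j)) * X j

theorem eval_linearForm (ℓ : Module.Dual ℂ V) (v : V) :
    eval (fun i => b.repr v i) (linearForm b ℓ) = ℓ v := by
  conv_rhs => rw [← b.sum_repr v]
  simp [linearForm, mul_comm]

/-- The contragredient action on `S(V^*) = ℂ[x₁, …, xₙ]`: `w` sends the linear form `x_i` to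
`x_i ∘ w⁻¹`. -/
def act (w : V ≃ₗᵢ[ℂ] V) : MvPolynomial (Fin n) ℂ →ₐ[ℂ] MvPolynomial (Fin n) ℂ :=
  aeval fun i => linearForm b
    ((b.toBasis.coord i).comp (w⁻¹ : V ≃ₗᵢ[ℂ] V).toLinearEquiv.toLinearMap)

/-- `(w · f)(v) = f(w⁻¹ v)`. -/
theorem eval_act (w : V ≃ₗᵢ[ℂ] V) (f : MvPolynomial (Fin n) ℂ) (v : V) :
    eval (fun i => b.repr v i) (act b w f) =
      eval (fun i => b.repr ((w⁻¹ : V ≃ₗᵢ[ℂ] V) v) i) f := by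
  induction f using MvPolynomial.induction_on with
  | C c => simp [act]
  | add p q hp hq => simp only [map_add, hp, hq]
  | mul_X p i hp =>
    rw [map_mul, map_mul, hp, map_mul]
    congr 1
    rw [act, aeval_X, eval_linearForm]
    simp

/-- The algebra `R = S^W` of invariant polynomials. -/
def invariants (W : Subgroup (V ≃ₗᵢ[ℂ] V)) : Subalgebra ℂ (MvPolynomial (Fin n) ℂ) where
  carrier := {f | ∀ w ∈ W, act b w f = f}
  mul_mem' hf hg w hw := by rw [map_mul, hf w hw, hg w hw]
  add_mem' hf hg w hw := by rw [map_add, hf w hw, hg w hw]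
  algebraMap_mem' c w _ := AlgHom.commutes _ c

/-- `h₁, …, hₙ` is a system of basic invariants: algebraically independent homogeneous generators
of the algebra of invariants. -/
structure IsBasicInvariants (W : Subgroup (V ≃ₗᵢ[ℂ] V)) (h : Fin n → MvPolynomial (Fin n) ℂ) :
    Prop where
  homogeneous : ∀ i, ∃ m : ℕ, (h i).IsHomogeneous m
  algebraicIndependent : AlgebraicIndependent ℂ h
  adjoin_eq : Algebra.adjoin ℂ (Set.range h) = invariants b W

/-- A canonical system: a system of basic invariants with `f_i^* f_j = δ_{ij}`. -/
structure IsCanonicalSystem (W : Subgroup (V ≃ₗᵢ[ℂ] V)) (f : Fin n → MvPolynomial (Fin n) ℂ) :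
    Prop where
  basic : IsBasicInvariants b W f
  starOp_eq : ∀ i j, starOp (f i) (f j) = if i = j then 1 else 0

/-- `Δ = ∏_H L_H ^ (e_H - 1)`, over the reflecting hyperplanes `H`, where `e_H` is the order of the
cyclic group of elements of `W` fixing `H` pointwise and `L_H` is a linear form with kernel `H`. -/
def discriminantForm (W : Subgroup (V ≃ₗᵢ[ℂ] V)) (L : Submodule ℂ V → Module.Dual ℂ V) :
    MvPolynomial (Fin n) ℂ :=
  ∏ᶠ H ∈ reflectingHyperplanes W,
    linearForm b (L H) ^ (Nat.card (pointwiseStabilizer W H) - 1)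

end Group

/-- `φ(f) = (f^* Δ)^* Δ`. -/
def phi {n : ℕ} (Δ f : MvPolynomial (Fin n) ℂ) : MvPolynomial (Fin n) ℂ :=
  starOp (starOp f Δ) Δ

end

end CanonicalInvariants

namespace CanonicalInvariants

open MvPolynomial

noncomputable section

/-! ### The algebra of the operators `f^*` -/

section StarOp

variable {n : ℕ}

/-! The map `f ↦ f^*` is a conjugate-linear, `W`-equivariant ring homomorphism, and multiplication
by `f` is adjoint to `f^*`. Write `R₊` for the invariants without constant term, `I` for the ideal
of `S` generated by `R₊`, and `F_h = ∑ⱼ xⱼ φ(∂ⱼ h)`.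

`Δ` is semi-invariant and divides every polynomial with the same character (`discriminantForm_dvd`),
so such a polynomial of degree below `deg Δ` vanishes. In particular `p^* Δ = 0` for `p ∈ R₊`;
conversely, everything annihilating `Δ` lies in `I` (`mem_coinvariantIdeal_of_starOp_eq_zero`).

The character of `Δ` has modulus one, so `φ` commutes with `W`, and `F_h` is invariant when `h` is.
For homogeneous `p ∈ R₊` the commutator of `p^*` with `xⱼ` gives `p^* F_h = (∑ⱼ ∂ⱼp · (∂ⱼh)^* Δ)^*
Δ`. If `deg p < deg h`, the inner sum is a semi-invariant of degree below `deg Δ`, hence zero;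
otherwise `p^* F_h` is constant for degree reasons. So `p^* F_h` is always constant
(`starOp_canonicalPoly_eq_C`).

The `F_{h_i}` are linearly independent: if `F_h = 0` for a combination `h = ∑ cᵢ hᵢ`, then `0 = ⟨h,
F_h⟩ = ∑ⱼ ‖(∂ⱼh)^* Δ‖²`, so every `∂ⱼ h` is in `I`. Euler's identity and averaging over `W` put `∑
cᵢ dᵢ hᵢ` into the span of `R₊ · R₊`, which forces `cᵢ = 0` (`linearIndependent_canonicalPoly`).

Gram–Schmidt keeps degrees, invariance and constancy of `p^* f`. Since `f_i^* f_j` is constant, it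
equals `⟨f_i, f_j⟩ = δ_{ij}`. Constancy also makes the `f_j` orthogonal to `R₊ · R₊`, so they span a
complement to it in `R₊` and generate `R` (`isBasicInvariants_of_starOp_eq_C`). -/

theorem coeff_diffMonomial_list (a : Fin n →₀ ℕ) (l : List (Fin n)) (hl : l.Nodup)
    (m : Fin n →₀ ℕ) (g : MvPolynomial (Fin n) ℂ) :
    coeff m ((l.map fun i =>
      ((pderiv i).toLinearMap ^ a i : Module.End ℂ (MvPolynomial (Fin n) ℂ))).prod g) =
      (l.map fun i => ((m i + 1).ascFactorial (a i) : ℂ)).prod *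
        coeff (m + (l.map fun i => Finsupp.single i (a i)).sum) g := by
  classical
  induction l generalizing m with
  | nil => simp
  | cons i l ih =>
    rw [List.nodup_cons] at hl
    simp only [List.map_cons, List.prod_cons, List.sum_cons, Module.End.mul_apply]
    rw [coeff_pderiv_pow_aux, ih hl.2, mul_assoc, add_assoc]
    congr 3
    refine List.map_congr_left fun j hj => ?_
    have hij : i ≠ j := fun h => hl.1 (h ▸ hj)
    simp [hij]

theorem coeff_diffMonomial (a m : Fin n →₀ ℕ) (g : MvPolynomial (Fin n) ℂ) :
    coeff m (diffMonomial a g) =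
      (∏ i, ((m i + 1).ascFactorial (a i) : ℂ)) * coeff (m + a) g := by
  rw [diffMonomial, coeff_diffMonomial_list a _ (List.nodup_finRange n)]
  simp only [← List.ofFn_eq_map, List.prod_ofFn, List.sum_ofFn]
  congr 3
  ext j
  simp

/-- On coefficients this is multiplicativity of rising factorials, so no separate argument that
partial derivatives commute is needed. -/
theorem diffMonomial_add (a b : Fin n →₀ ℕ) :
    diffMonomial (a + b) = diffMonomial a * diffMonomial b := by
  refine LinearMap.ext fun g => MvPolynomial.ext _ _ fun m => ?_
  rw [Module.End.mul_apply, coeff_diffMonomial, coeff_diffMonomial, coeff_diffMonomial,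
    ← mul_assoc, ← Finset.prod_mul_distrib, add_assoc]
  congr 1
  refine Finset.prod_congr rfl fun i _ => ?_
  have := Nat.ascFactorial_mul_ascFactorial (m i + 1) (a i) (b i)
  rw [Finsupp.add_apply, Finsupp.add_apply, ← this]
  push_cast
  ring_nf

theorem starOp_eq_sum (f : MvPolynomial (Fin n) ℂ) (s : Finset (Fin n →₀ ℕ))
    (hs : f.support ⊆ s) :
    starOp f = ∑ a ∈ s, starRingEnd ℂ (f.coeff a) • diffMonomial a := by
  rw [starOp]
  refine Finset.sum_subset hs fun a _ ha => ?_
  simp [notMem_support_iff.mp ha]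

theorem starOp_add (f g : MvPolynomial (Fin n) ℂ) : starOp (f + g) = starOp f + starOp g := by
  classical
  rw [starOp_eq_sum (f + g) _ support_add, starOp_eq_sum f _ Finset.subset_union_left,
    starOp_eq_sum g _ Finset.subset_union_right, ← Finset.sum_add_distrib]
  exact Finset.sum_congr rfl fun a _ => by rw [coeff_add, map_add, add_smul]

theorem starOp_smul (c : ℂ) (f : MvPolynomial (Fin n) ℂ) :
    starOp (c • f) = starRingEnd ℂ c • starOp f := by
  rw [starOp_eq_sum (c • f) _ support_smul, starOp, Finset.smul_sum]
  exact Finset.sum_congr rfl fun a _ => by rw [coeff_smul, smul_eq_mul, map_mul, mul_smul]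

/-- `f ↦ f^*` as a conjugate-linear map. -/
def starOpHom (n : ℕ) :
    MvPolynomial (Fin n) ℂ →ₛₗ[starRingEnd ℂ] Module.End ℂ (MvPolynomial (Fin n) ℂ) where
  toFun := starOp
  map_add' := starOp_add
  map_smul' := starOp_smul

@[simp] theorem starOp_zero : starOp (0 : MvPolynomial (Fin n) ℂ) = 0 := map_zero (starOpHom n)

theorem starOp_sub (f g : MvPolynomial (Fin n) ℂ) : starOp (f - g) = starOp f - starOp g :=
  map_sub (starOpHom n) f g

theorem starOp_sum {ι : Type*} (s : Finset ι) (f : ι → MvPolynomial (Fin n) ℂ) :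
    starOp (∑ i ∈ s, f i) = ∑ i ∈ s, starOp (f i) :=
  map_sum (starOpHom n) f s

theorem starOp_monomial (a : Fin n →₀ ℕ) (c : ℂ) :
    starOp (monomial a c) = starRingEnd ℂ c • diffMonomial a := by
  classical
  rw [starOp_eq_sum _ {a} support_monomial_subset]
  simp

theorem starOp_mul (f g : MvPolynomial (Fin n) ℂ) : starOp (f * g) = starOp f * starOp g := by
  induction f using MvPolynomial.induction_on' with
  | add p q hp hq => rw [add_mul, starOp_add, hp, hq, starOp_add, add_mul]
  | monomial a c =>
    induction g using MvPolynomial.induction_on' with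
    | add p q hp hq => rw [mul_add, starOp_add, hp, hq, starOp_add, mul_add]
    | monomial b d =>
      rw [monomial_mul, starOp_monomial, starOp_monomial, starOp_monomial, diffMonomial_add,
        map_mul, smul_mul_smul_comm]

theorem starOp_mul_apply (f g q : MvPolynomial (Fin n) ℂ) :
    starOp (f * g) q = starOp f (starOp g q) := by
  rw [starOp_mul, Module.End.mul_apply]

theorem starOp_C (c : ℂ) : starOp (C c : MvPolynomial (Fin n) ℂ) = starRingEnd ℂ c • 1 := by
  rw [C_apply, starOp_monomial]
  congr 1
  refine LinearMap.ext fun g => MvPolynomial.ext _ _ fun m => ?_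
  simp [coeff_diffMonomial]

theorem starOp_one : starOp (1 : MvPolynomial (Fin n) ℂ) = 1 := by
  simpa using starOp_C (n := n) 1

theorem starOp_X (i : Fin n) : starOp (X i) = (pderiv i).toLinearMap := by
  classical
  rw [X, starOp_monomial, map_one, one_smul]
  refine LinearMap.ext fun g => MvPolynomial.ext _ _ fun m => ?_
  rw [coeff_diffMonomial]
  change _ = coeff m (pderiv i g)
  rw [coeff_pderiv, Finset.prod_eq_single i]
  · simp [Nat.ascFactorial_succ, mul_comm]
  · intro j _ hj
    simp [hj.symm]
  · simp

theorem starOp_X_apply (i : Fin n) (g : MvPolynomial (Fin n) ℂ) :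
    starOp (X i) g = pderiv i g := by
  rw [starOp_X]; rfl

theorem starOp_smul_apply (c : ℂ) (f g : MvPolynomial (Fin n) ℂ) :
    starOp (c • f) g = starRingEnd ℂ c • starOp f g := by
  rw [starOp_smul, LinearMap.smul_apply]

/-- The commutator of `p^*` with multiplication by a coordinate. -/
theorem starOp_X_mul (p F : MvPolynomial (Fin n) ℂ) (j : Fin n) :
    starOp p (X j * F) = X j * starOp p F + starOp (pderiv j p) F := by
  induction p using MvPolynomial.induction_on generalizing F with
  | C c => simp [starOp_C]
  | add p q hp hq =>
    simp only [starOp_add, map_add, LinearMap.add_apply, hp, hq]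
    ring
  | mul_X p i hp =>
    classical
    rw [starOp_mul_apply, starOp_X_apply, starOp_mul_apply, starOp_X_apply, Derivation.leibniz,
      map_add, smul_eq_mul, smul_eq_mul, hp, Derivation.leibniz, smul_eq_mul, smul_eq_mul,
      starOp_add, LinearMap.add_apply, starOp_mul_apply, mul_comm (X i), starOp_mul_apply,
      starOp_X_apply, pderiv_X, pderiv_X]
    by_cases hij : i = j
    · subst hij; simp [starOp_one]; ring
    · simp [hij, Ne.symm hij]

theorem degree_of_isHomogeneous {k : ℕ} {f : MvPolynomial (Fin n) ℂ} (hf : f.IsHomogeneous k)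
    {m : Fin n →₀ ℕ} (hm : coeff m f ≠ 0) : m.degree = k := by
  rw [Finsupp.degree_eq_weight_one]
  exact hf hm

theorem degree_of_coeff_starOp_ne_zero {k N : ℕ} {f g : MvPolynomial (Fin n) ℂ}
    (hf : f.IsHomogeneous k) (hg : g.IsHomogeneous N) {m : Fin n →₀ ℕ}
    (hm : coeff m (starOp f g) ≠ 0) : m.degree + k = N := by
  rw [starOp, LinearMap.sum_apply, coeff_sum] at hm
  obtain ⟨a, ha, hne⟩ := Finset.exists_ne_zero_of_sum_ne_zero hm
  rw [LinearMap.smul_apply, coeff_smul, coeff_diffMonomial] at hne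
  have h1 : coeff (m + a) g ≠ 0 := fun h0 => hne (by simp [h0])
  have h2 := degree_of_isHomogeneous hg h1
  have h3 := degree_of_isHomogeneous hf (mem_support_iff.mp ha)
  rw [map_add] at h2
  omega

theorem isHomogeneous_of_degree {k : ℕ} {f : MvPolynomial (Fin n) ℂ}
    (h : ∀ m, coeff m f ≠ 0 → m.degree = k) : f.IsHomogeneous k := by
  intro m hm
  rw [← h m hm, Finsupp.degree_eq_weight_one]
  rfl

theorem isHomogeneous_starOp {k l N : ℕ} (hkl : l + k = N) {f g : MvPolynomial (Fin n) ℂ}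
    (hf : f.IsHomogeneous k) (hg : g.IsHomogeneous N) : (starOp f g).IsHomogeneous l :=
  isHomogeneous_of_degree fun m hm => by
    have := degree_of_coeff_starOp_ne_zero hf hg hm
    omega

theorem starOp_eq_zero_of_lt {k N : ℕ} (hkN : N < k) {f g : MvPolynomial (Fin n) ℂ}
    (hf : f.IsHomogeneous k) (hg : g.IsHomogeneous N) : starOp f g = 0 := by
  ext m
  by_contra hm
  have := degree_of_coeff_starOp_ne_zero hf hg hm
  omega

theorem pairing_mul_left (f q g : MvPolynomial (Fin n) ℂ) :
    pairing (f * q) g = pairing q (starOp f g) := by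
  rw [pairing, mul_comm, starOp_mul_apply, pairing]

theorem pairing_conj_symm (f g : MvPolynomial (Fin n) ℂ) :
    starRingEnd ℂ (pairing g f) = pairing f g :=
  (pairingCore n).conj_inner_symm f g

theorem pairing_X_mul_right (f g : MvPolynomial (Fin n) ℂ) (j : Fin n) :
    pairing f (X j * g) = pairing (pderiv j f) g := by
  rw [← pairing_conj_symm, pairing_mul_left, starOp_X_apply, pairing_conj_symm]

theorem pairing_self_eq_zero {f : MvPolynomial (Fin n) ℂ} (hf : pairing f f = 0) : f = 0 :=
  (pairingCore n).definite f hf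

theorem pairing_self_nonneg (f : MvPolynomial (Fin n) ℂ) : 0 ≤ (pairing f f).re :=
  (pairingCore n).re_inner_nonneg f

theorem pairing_sum_right {ι : Type*} (s : Finset ι) (f : MvPolynomial (Fin n) ℂ)
    (g : ι → MvPolynomial (Fin n) ℂ) : pairing f (∑ i ∈ s, g i) = ∑ i ∈ s, pairing f (g i) := by
  simp only [pairing, map_sum]

theorem pairing_eq_zero_of_degree_ne {k l : ℕ} (hkl : k ≠ l) {f g : MvPolynomial (Fin n) ℂ}
    (hf : f.IsHomogeneous k) (hg : g.IsHomogeneous l) : pairing f g = 0 := by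
  rw [pairing, show eval (0 : Fin n → ℂ) = constantCoeff from eval_zero, constantCoeff_eq]
  by_contra hm
  have := degree_of_coeff_starOp_ne_zero hf hg hm
  rw [map_zero] at this
  omega

theorem phi_smul (Δ f : MvPolynomial (Fin n) ℂ) (c : ℂ) : phi Δ (c • f) = c • phi Δ f := by
  simp only [phi, starOp_smul, LinearMap.smul_apply, Complex.conj_conj]

theorem phi_sum {ι : Type*} (s : Finset ι) (Δ : MvPolynomial (Fin n) ℂ)
    (g : ι → MvPolynomial (Fin n) ℂ) : phi Δ (∑ i ∈ s, g i) = ∑ i ∈ s, phi Δ (g i) := by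
  simp only [phi, starOp_sum, LinearMap.sum_apply]

/-- The degree goes from `k` to `N - k` and back to `k`; when `k > N` the result is zero, which is
homogeneous of every degree. -/
theorem isHomogeneous_phi {k N : ℕ} {Δ f : MvPolynomial (Fin n) ℂ} (hf : f.IsHomogeneous k)
    (hΔ : Δ.IsHomogeneous N) : (phi Δ f).IsHomogeneous k := by
  rcases le_or_gt k N with h | h
  · exact isHomogeneous_starOp (by omega)
      (isHomogeneous_starOp (Nat.sub_add_cancel h) hf hΔ) hΔ
  · rw [phi, starOp_eq_zero_of_lt h hf hΔ, starOp_zero]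
    exact isHomogeneous_zero _ _ _

/-- Adjointness of multiplication by `g` and `g^*`, used twice. Thus `φ` is positive semidefinite,
with kernel the annihilator of `Δ`. -/
theorem pairing_phi_self (Δ f : MvPolynomial (Fin n) ℂ) :
    pairing f (phi Δ f) = pairing (starOp f Δ) (starOp f Δ) := by
  rw [phi, ← pairing_mul_left, mul_comm, pairing_mul_left]

end StarOp

/-! ### The action of unitary transformations -/

section Action

variable {n : ℕ} {V : Type*} [NormedAddCommGroup V] [InnerProductSpace ℂ V]
  (b : OrthonormalBasis (Fin n) ℂ V)

theorem ext_of_eval_repr {f g : MvPolynomial (Fin n) ℂ}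
    (h : ∀ v : V, eval (fun i => b.repr v i) f = eval (fun i => b.repr v i) g) : f = g := by
  refine MvPolynomial.funext fun x => ?_
  have := h (b.repr.symm (WithLp.toLp 2 x))
  simpa using this

theorem act_linearForm (w : V ≃ₗᵢ[ℂ] V) (ℓ : Module.Dual ℂ V) :
    act b w (linearForm b ℓ) =
      linearForm b (ℓ.comp (w⁻¹ : V ≃ₗᵢ[ℂ] V).toLinearEquiv.toLinearMap) := by
  refine ext_of_eval_repr b fun v => ?_
  rw [eval_act, eval_linearForm, eval_linearForm]
  rfl

theorem act_mul (w u : V ≃ₗᵢ[ℂ] V) (f : MvPolynomial (Fin n) ℂ) :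
    act b (w * u) f = act b w (act b u f) := by
  refine ext_of_eval_repr b fun v => ?_
  rw [eval_act, eval_act, eval_act, mul_inv_rev]
  rfl

theorem act_one (f : MvPolynomial (Fin n) ℂ) : act b 1 f = f := by
  refine ext_of_eval_repr b fun v => ?_
  rw [eval_act, inv_one]
  rfl

theorem act_inv_act (w : V ≃ₗᵢ[ℂ] V) (f : MvPolynomial (Fin n) ℂ) :
    act b w⁻¹ (act b w f) = f := by
  rw [← act_mul, inv_mul_cancel, act_one]

/-- The matrix of `w` acting on the coordinates. -/
def actMatrix (w : V ≃ₗᵢ[ℂ] V) (j k : Fin n) : ℂ := inner ℂ (w (b j)) (b k)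

theorem act_X (w : V ≃ₗᵢ[ℂ] V) (j : Fin n) :
    act b w (X j) = ∑ k, C (actMatrix b w j k) * X k := by
  rw [act, aeval_X, linearForm]
  refine Finset.sum_congr rfl fun k _ => ?_
  congr 2
  change b.repr (w.symm (b k)) j = _
  rw [b.repr_apply_apply, actMatrix, ← w.inner_map_map (b j), w.apply_symm_apply]

theorem actMatrix_row (w : V ≃ₗᵢ[ℂ] V) (i j : Fin n) :
    ∑ k, starRingEnd ℂ (actMatrix b w i k) * actMatrix b w j k = if i = j then 1 else 0 := by
  have h := b.sum_inner_mul_inner (w (b j)) (w (b i))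
  rw [w.inner_map_map, b.inner_eq_ite] at h
  simp only [eq_comm (a := i)]
  rw [← h]
  refine Finset.sum_congr rfl fun k _ => ?_
  rw [actMatrix, actMatrix, inner_conj_symm, mul_comm]

theorem actMatrix_col (w : V ≃ₗᵢ[ℂ] V) (k l : Fin n) :
    ∑ j, starRingEnd ℂ (actMatrix b w j k) * actMatrix b w j l = if k = l then 1 else 0 := by
  have h := b.sum_inner_mul_inner (w.symm (b k)) (w.symm (b l))
  rw [w.symm.inner_map_map, b.inner_eq_ite] at h
  rw [← h]
  refine Finset.sum_congr rfl fun j _ => ?_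
  have h1 : ∀ k, actMatrix b w j k = inner ℂ (b j) (w.symm (b k)) := fun k => by
    rw [actMatrix, ← w.inner_map_map (b j), w.apply_symm_apply]
  rw [h1, h1, inner_conj_symm]

theorem pderiv_act (w : V ≃ₗᵢ[ℂ] V) (k : Fin n) (f : MvPolynomial (Fin n) ℂ) :
    pderiv k (act b w f) = ∑ j, actMatrix b w j k • act b w (pderiv j f) := by
  classical
  induction f using MvPolynomial.induction_on with
  | C c => simp
  | add p q hp hq => simp only [map_add, hp, hq, smul_add, Finset.sum_add_distrib]
  | mul_X p i hp =>
    have hX : pderiv k (act b w (X i)) = C (actMatrix b w i k) := by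
      rw [act_X, map_sum, Finset.sum_eq_single k]
      · simp
      · intro l _ hl
        simp [pderiv_X_of_ne hl]
      · simp
    have h2 : ∀ j, act b w (pderiv j (p * X i)) =
        act b w p * (if i = j then 1 else 0) + act b w (X i) * act b w (pderiv j p) := fun j => by
      rw [Derivation.leibniz, map_add, smul_eq_mul, smul_eq_mul, map_mul, map_mul, pderiv_X,
        Pi.single_apply]
      split_ifs with h <;> simp_all
    rw [map_mul, Derivation.leibniz, hX, hp]
    simp only [h2, smul_add, Finset.sum_add_distrib]
    congr 1
    · rw [Finset.sum_eq_single i]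
      · simp [smul_eq_C_mul, mul_comm]
      · intro j _ hj
        simp [hj.symm]
      · simp
    · rw [smul_eq_mul, Finset.mul_sum]
      exact Finset.sum_congr rfl fun j _ => mul_smul_comm _ _ _

/-- Unitarity inverts the matrix in `pderiv_act`. The conjugate entries are those produced by
applying `starOp` to `act b w (X i)`, which makes `f ↦ f^*` equivariant. -/
theorem act_pderiv (w : V ≃ₗᵢ[ℂ] V) (i : Fin n) (f : MvPolynomial (Fin n) ℂ) :
    act b w (pderiv i f) =
      ∑ k, starRingEnd ℂ (actMatrix b w i k) • pderiv k (act b w f) := by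
  simp only [pderiv_act, Finset.smul_sum, smul_smul]
  rw [Finset.sum_comm]
  simp only [← Finset.sum_smul, actMatrix_row, ite_smul, one_smul, zero_smul]
  simp

/-- The operators `f^*` are equivariant. -/
theorem act_starOp (w : V ≃ₗᵢ[ℂ] V) (f g : MvPolynomial (Fin n) ℂ) :
    act b w (starOp f g) = starOp (act b w f) (act b w g) := by
  induction f using MvPolynomial.induction_on generalizing g with
  | C c => simp [starOp_C]
  | add p q hp hq => simp only [starOp_add, map_add, LinearMap.add_apply, hp, hq]
  | mul_X p i hp =>
    rw [starOp_mul_apply, starOp_X_apply, hp, map_mul, starOp_mul_apply, act_pderiv, act_X,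
      starOp_sum, LinearMap.sum_apply]
    congr 1
    refine Finset.sum_congr rfl fun k _ => ?_
    rw [← smul_eq_C_mul, starOp_smul_apply, starOp_X_apply]

theorem isHomogeneous_linearForm (ℓ : Module.Dual ℂ V) : (linearForm b ℓ).IsHomogeneous 1 :=
  IsHomogeneous.sum _ _ _ fun j _ => (isHomogeneous_X ℂ j).C_mul _

theorem linearForm_smul (c : ℂ) (ℓ : Module.Dual ℂ V) :
    linearForm b (c • ℓ) = c • linearForm b ℓ := by
  refine ext_of_eval_repr b fun v => ?_
  rw [smul_eval, eval_linearForm, eval_linearForm]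
  rfl

theorem linearForm_injective : Function.Injective (linearForm (n := n) b) := by
  intro ℓ ℓ' h
  refine LinearMap.ext fun v => ?_
  rw [← eval_linearForm b, h, eval_linearForm]

theorem constantCoeff_act (w : V ≃ₗᵢ[ℂ] V) (f : MvPolynomial (Fin n) ℂ) :
    constantCoeff (act b w f) = constantCoeff f := by
  have := eval_act b w f 0
  simpa [← eval_zero] using this

theorem act_pow_eq {w : V ≃ₗᵢ[ℂ] V} {f : MvPolynomial (Fin n) ℂ} {c : ℂ}
    (h : act b w f = c • f) (k : ℕ) : act b (w ^ k) f = c ^ k • f := by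
  induction k with
  | zero => simp [act_one]
  | succ k ih => rw [pow_succ, act_mul, h, map_smul, ih, smul_smul, pow_succ, mul_comm]

theorem act_inv_eq {w : V ≃ₗᵢ[ℂ] V} {f : MvPolynomial (Fin n) ℂ} {c : ℂ} (hc : c ≠ 0)
    (h : act b w f = c • f) : act b w⁻¹ f = c⁻¹ • f := by
  have := act_inv_act b w f
  rw [h, map_smul] at this
  rwa [eq_inv_smul_iff₀ hc]

end Action

/-! ### Reflecting hyperplanes and the polynomial `Δ` -/

section Hyperplanes

variable {n : ℕ} {V : Type*} [NormedAddCommGroup V] [InnerProductSpace ℂ V]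
  (b : OrthonormalBasis (Fin n) ℂ V)

theorem exists_eq_smul_of_ker_le {ℓ ℓ' : Module.Dual ℂ V}
    (h : LinearMap.ker ℓ ≤ LinearMap.ker ℓ') : ∃ c : ℂ, ℓ' = c • ℓ := by
  have := mem_span_of_iInf_ker_le_ker (ι := Unit) (L := fun _ => ℓ) (K := ℓ') (by simpa using h)
  rw [Set.range_const, Submodule.mem_span_singleton] at this
  obtain ⟨c, hc⟩ := this
  exact ⟨c, hc.symm⟩

theorem linearForm_ne_zero {ℓ : Module.Dual ℂ V} (hℓ : ℓ ≠ 0) : linearForm b ℓ ≠ 0 := by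
  have h0 : linearForm b (0 : Module.Dual ℂ V) = 0 := by simp [linearForm]
  exact fun h => hℓ (linearForm_injective b (h.trans h0.symm))

theorem prime_linearForm {ℓ : Module.Dual ℂ V} (hℓ : ℓ ≠ 0) : Prime (linearForm b ℓ) := by
  have h0 := linearForm_ne_zero b hℓ
  rw [← irreducible_iff_prime]
  refine irreducible_of_totalDegree_eq_one
    ((isHomogeneous_linearForm b ℓ).totalDegree h0) fun x hx => ?_
  rw [isUnit_iff_ne_zero]
  rintro rfl
  exact h0 (MvPolynomial.ext _ _ fun m => by simpa using hx m)

theorem exists_smul_of_linearForm_dvd {ℓ ℓ' : Module.Dual ℂ V} (hℓ' : ℓ' ≠ 0)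
    (h : linearForm b ℓ ∣ linearForm b ℓ') : LinearMap.ker ℓ = LinearMap.ker ℓ' := by
  have h1 : LinearMap.ker ℓ ≤ LinearMap.ker ℓ' := by
    intro v hv
    obtain ⟨r, hr⟩ := h
    rw [LinearMap.mem_ker] at hv ⊢
    rw [← eval_linearForm b, hr, map_mul, eval_linearForm, hv, zero_mul]
  obtain ⟨c, rfl⟩ := exists_eq_smul_of_ker_le h1
  have hc : c ≠ 0 := by
    rintro rfl
    exact hℓ' (zero_smul _ _)
  exact (LinearMap.ker_smul ℓ c hc).symm

variable {W : Subgroup (V ≃ₗᵢ[ℂ] V)} {H : Submodule ℂ V} {ℓ : Module.Dual ℂ V}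

theorem ne_zero_of_mem_reflectingHyperplanes (hH : H ∈ reflectingHyperplanes W)
    (hℓ : LinearMap.ker ℓ = H) : ℓ ≠ 0 := by
  rintro rfl
  obtain ⟨s, ⟨_, hs⟩, rfl⟩ := hH
  rw [IsUnitaryReflection, ← hℓ, LinearMap.ker_zero, finrank_top] at hs
  omega

theorem apply_symm_of_mem_stabilizer {s : V ≃ₗᵢ[ℂ] V} (hs : s ∈ pointwiseStabilizer W H)
    {v : V} (hv : v ∈ H) : (s⁻¹ : V ≃ₗᵢ[ℂ] V) v = v :=
  ((pointwiseStabilizer W H).inv_mem hs).2 v hv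

theorem exists_act_linearForm_eq {s : V ≃ₗᵢ[ℂ] V} (hs : s ∈ pointwiseStabilizer W H)
    (hℓ : LinearMap.ker ℓ = H) : ∃ c : ℂ, act b s (linearForm b ℓ) = c • linearForm b ℓ := by
  obtain ⟨c, hc⟩ := exists_eq_smul_of_ker_le (ℓ := ℓ)
    (ℓ' := ℓ.comp (s⁻¹ : V ≃ₗᵢ[ℂ] V).toLinearEquiv.toLinearMap) (by
      intro v hv
      have h1 : (s⁻¹ : V ≃ₗᵢ[ℂ] V) v = v := apply_symm_of_mem_stabilizer hs (hℓ ▸ hv)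
      change ℓ ((s⁻¹ : V ≃ₗᵢ[ℂ] V) v) = 0
      rw [h1]
      exact hv)
  exact ⟨c, by rw [act_linearForm, hc, linearForm_smul]⟩

/-- For `v ⊥ H`, the vector `s⁻¹v - v` lies in `H` because `ℓ` is preserved and in `Hᗮ` because `s`
is unitary. So `s` fixes both `H` and `Hᗮ`. -/
theorem eq_one_of_act_linearForm_eq {s : V ≃ₗᵢ[ℂ] V} (hs : s ∈ pointwiseStabilizer W H)
    (hℓ : LinearMap.ker ℓ = H) (h : act b s (linearForm b ℓ) = linearForm b ℓ) : s = 1 := by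
  have : FiniteDimensional ℂ V := b.toBasis.finiteDimensional_of_finite
  rw [act_linearForm] at h
  have h1 := linearForm_injective b h
  have key : ∀ v ∈ Hᗮ, (s⁻¹ : V ≃ₗᵢ[ℂ] V) v = v := by
    intro v hv
    have h2 : (s⁻¹ : V ≃ₗᵢ[ℂ] V) v - v ∈ H := by
      rw [← hℓ, LinearMap.mem_ker, map_sub, sub_eq_zero]
      exact LinearMap.congr_fun h1 v
    have h3 : (s⁻¹ : V ≃ₗᵢ[ℂ] V) v - v ∈ Hᗮ := by
      refine Submodule.sub_mem _ ?_ hv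
      rw [Submodule.mem_orthogonal]
      intro u hu
      rw [← apply_symm_of_mem_stabilizer hs hu, LinearIsometryEquiv.inner_map_map]
      exact (Submodule.mem_orthogonal _ _).mp hv u hu
    have := Submodule.mem_inf.mpr ⟨h2, h3⟩
    rw [Submodule.inf_orthogonal_eq_bot, Submodule.mem_bot, sub_eq_zero] at this
    exact this
  rw [← inv_eq_one]
  refine LinearIsometryEquiv.ext fun v => ?_
  have hv : v ∈ H ⊔ Hᗮ := by
    rw [Submodule.sup_orthogonal_of_hasOrthogonalProjection]; trivial
  obtain ⟨x, hx, y, hy, rfl⟩ := Submodule.mem_sup.mp hv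
  rw [map_add, key y hy, apply_symm_of_mem_stabilizer hs hx]
  rfl

/-- On each coordinate the difference is a linear form vanishing on `H`, hence a multiple of `ℓ`; a
Leibniz-type identity extends this to products. -/
theorem linearForm_dvd_act_sub {s : V ≃ₗᵢ[ℂ] V} (hs : s ∈ pointwiseStabilizer W H)
    (hℓ : LinearMap.ker ℓ = H) (f : MvPolynomial (Fin n) ℂ) :
    linearForm b ℓ ∣ act b s f - f := by
  induction f using MvPolynomial.induction_on with
  | C c => simp
  | add p q hp hq =>
    rw [map_add, add_sub_add_comm]
    exact dvd_add hp hq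
  | mul_X p i hp =>
    have hX : linearForm b ℓ ∣ act b s (X i) - X i := by
      let μ : Module.Dual ℂ V :=
        (b.toBasis.coord i).comp (s⁻¹ : V ≃ₗᵢ[ℂ] V).toLinearEquiv.toLinearMap - b.toBasis.coord i
      have hμ : act b s (X i) - X i = linearForm b μ := by
        refine ext_of_eval_repr b fun v => ?_
        rw [map_sub, eval_act, eval_linearForm, eval_X, eval_X]
        simp [μ]
      obtain ⟨c, hc⟩ := exists_eq_smul_of_ker_le (ℓ := ℓ) (ℓ' := μ) (by
        intro v hv
        have h1 : (s⁻¹ : V ≃ₗᵢ[ℂ] V) v = v := apply_symm_of_mem_stabilizer hs (hℓ ▸ hv)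
        change b.toBasis.coord i ((s⁻¹ : V ≃ₗᵢ[ℂ] V) v) - b.toBasis.coord i v = 0
        rw [h1, sub_self])
      rw [hμ, hc, linearForm_smul, smul_eq_C_mul]
      exact dvd_mul_left _ _
    have : act b s (p * X i) - p * X i =
        act b s p * (act b s (X i) - X i) + (act b s p - p) * X i := by
      rw [map_mul]; ring
    rw [this]
    exact dvd_add (hX.mul_left _) (hp.mul_right _)

instance finite_pointwiseStabilizer [Finite W] : Finite (pointwiseStabilizer W H) :=
  Finite.of_injective (fun s => (⟨s.1, s.2.1⟩ : W)) fun _ _ h =>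
    Subtype.ext (congrArg (fun x : W => (x : V ≃ₗᵢ[ℂ] V)) h)

/-- The eigenvalue of an element of the stabilizer of `H` on the linear form defining `H`
determines the element and is a root of unity of order dividing `e_H`. -/
theorem pow_card_eq_one_of_act_linearForm {s : V ≃ₗᵢ[ℂ] V} (hs : s ∈ pointwiseStabilizer W H)
    (hℓ0 : ℓ ≠ 0) {c : ℂ} (hc : act b s (linearForm b ℓ) = c • linearForm b ℓ) :
    c ^ Nat.card (pointwiseStabilizer W H) = 1 := by
  have h1 : s ^ Nat.card (pointwiseStabilizer W H) = 1 := by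
    have := pow_card_eq_one' (x := (⟨s, hs⟩ : pointwiseStabilizer W H))
    exact congrArg Subtype.val this
  have h2 := act_pow_eq b hc (Nat.card (pointwiseStabilizer W H))
  rw [h1, act_one] at h2
  have h3 : (c ^ Nat.card (pointwiseStabilizer W H) - 1) • linearForm b ℓ = 0 := by
    rw [sub_smul, ← h2, one_smul, sub_self]
  rcases smul_eq_zero.mp h3 with h | h
  · exact sub_eq_zero.mp h
  · exact absurd h (linearForm_ne_zero b hℓ0)

/-- The eigenvalue on `ℓ` determines the element of the stabilizer, and there are at most `k`
complex `k`-th roots of unity. Counting replaces the cyclicity of the stabilizer. -/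
theorem exists_pow_ne_one_of_lt (hℓ : LinearMap.ker ℓ = H) {k : ℕ} (hk0 : 0 < k)
    (hk : k < Nat.card (pointwiseStabilizer W H)) :
    ∃ s ∈ pointwiseStabilizer W H, ∃ c : ℂ,
      act b s (linearForm b ℓ) = c • linearForm b ℓ ∧ c ^ k ≠ 1 := by
  classical
  by_contra! hcon
  choose c hc using fun s : pointwiseStabilizer W H => exists_act_linearForm_eq b s.2 hℓ
  have hinj : Function.Injective fun s : pointwiseStabilizer W H =>
      (⟨c s, (Polynomial.mem_nthRootsFinset hk0 1).mpr (hcon s s.2 (c s) (hc s))⟩ :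
        Polynomial.nthRootsFinset k (1 : ℂ)) := by
    intro s t hst
    have hst' : c s = c t := congrArg Subtype.val hst
    have h1 : act b ((s : V ≃ₗᵢ[ℂ] V)⁻¹ * t) (linearForm b ℓ) = linearForm b ℓ := by
      rw [act_mul, hc t, ← hst', ← hc s, act_inv_act]
    have h2 := eq_one_of_act_linearForm_eq b
      ((pointwiseStabilizer W H).mul_mem ((pointwiseStabilizer W H).inv_mem s.2) t.2) hℓ h1
    exact Subtype.ext (inv_mul_eq_one.mp h2)
  have h1 := Nat.card_le_card_of_injective _ hinj
  rw [Nat.card_eq_fintype_card (α := Polynomial.nthRootsFinset k (1 : ℂ)), Fintype.card_coe] at h1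
  have h2 : (Polynomial.nthRootsFinset k (1 : ℂ)).card ≤ k := by
    rw [Polynomial.nthRootsFinset]
    exact (Multiset.toFinset_card_le _).trans (Polynomial.card_nthRoots _ _)
  omega

end Hyperplanes

/-! ### Semi-invariance of `Δ` and divisibility by `Δ`. -/

section Discriminant

variable {n : ℕ} {V : Type*} [NormedAddCommGroup V] [InnerProductSpace ℂ V]
  (b : OrthonormalBasis (Fin n) ℂ V) {W : Subgroup (V ≃ₗᵢ[ℂ] V)}

theorem fixedSpace_conj (w s : V ≃ₗᵢ[ℂ] V) :
    fixedSpace (w * s * w⁻¹) = (fixedSpace s).map (w.toLinearEquiv : V →ₗ[ℂ] V) := by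
  ext v
  constructor
  · intro hv
    refine ⟨w⁻¹ v, ?_, w.apply_symm_apply v⟩
    change w (s (w⁻¹ v)) = v at hv
    change s (w⁻¹ v) = w.symm v
    rw [LinearIsometryEquiv.eq_symm_apply]
    exact hv
  · rintro ⟨u, hu, rfl⟩
    change w (s (w.symm (w u))) = w u
    rw [w.symm_apply_apply]
    exact congrArg w hu

theorem map_mem_reflectingHyperplanes {w : V ≃ₗᵢ[ℂ] V} (hw : w ∈ W) {H : Submodule ℂ V}
    (hH : H ∈ reflectingHyperplanes W) :
    H.map (w.toLinearEquiv : V →ₗ[ℂ] V) ∈ reflectingHyperplanes W := by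
  obtain ⟨s, ⟨hs, hs'⟩, rfl⟩ := hH
  refine ⟨w * s * w⁻¹, ⟨W.mul_mem (W.mul_mem hw hs) (W.inv_mem hw), ?_⟩, fixedSpace_conj w s⟩
  rw [IsUnitaryReflection, fixedSpace_conj]
  rw [IsUnitaryReflection] at hs'
  rw [← hs']
  congr 1
  exact LinearEquiv.finrank_map_eq w.toLinearEquiv (fixedSpace s)

theorem map_inv_map (w : V ≃ₗᵢ[ℂ] V) (H : Submodule ℂ V) :
    (H.map (w.toLinearEquiv : V →ₗ[ℂ] V)).map
      ((w⁻¹ : V ≃ₗᵢ[ℂ] V).toLinearEquiv : V →ₗ[ℂ] V) = H := by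
  rw [← Submodule.map_comp]
  convert Submodule.map_id H
  ext v
  exact w.symm_apply_apply v

theorem map_map_inv (w : V ≃ₗᵢ[ℂ] V) (H : Submodule ℂ V) :
    (H.map ((w⁻¹ : V ≃ₗᵢ[ℂ] V).toLinearEquiv : V →ₗ[ℂ] V)).map
      (w.toLinearEquiv : V →ₗ[ℂ] V) = H := by
  have := map_inv_map w⁻¹ H
  rwa [inv_inv] at this

theorem card_pointwiseStabilizer_map {w : V ≃ₗᵢ[ℂ] V} (hw : w ∈ W) (H : Submodule ℂ V) :
    Nat.card (pointwiseStabilizer W (H.map (w.toLinearEquiv : V →ₗ[ℂ] V))) =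
      Nat.card (pointwiseStabilizer W H) := by
  have key : pointwiseStabilizer W (H.map (w.toLinearEquiv : V →ₗ[ℂ] V)) =
      (pointwiseStabilizer W H).map (MulAut.conj w).toMonoidHom := by
    ext s
    constructor
    · rintro ⟨hs, hfix⟩
      refine ⟨w⁻¹ * s * w, ⟨W.mul_mem (W.mul_mem (W.inv_mem hw) hs) hw, fun v hv => ?_⟩, ?_⟩
      · change w.symm (s (w v)) = v
        rw [hfix (w v) ⟨v, hv, rfl⟩, w.symm_apply_apply]
      · change w * (w⁻¹ * s * w) * w⁻¹ = s
        group
    · rintro ⟨t, ⟨ht, hfix⟩, rfl⟩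
      refine ⟨W.mul_mem (W.mul_mem hw ht) (W.inv_mem hw), ?_⟩
      rintro _ ⟨u, hu, rfl⟩
      change w (t (w.symm (w u))) = w u
      rw [w.symm_apply_apply, hfix u hu]
  rw [key]
  exact Nat.card_congr ((pointwiseStabilizer W H).equivMapOfInjective _
    (MulAut.conj w).injective).symm.toEquiv

variable {L : Submodule ℂ V → Module.Dual ℂ V}

theorem act_linearForm_reflecting
    (hL : ∀ H ∈ reflectingHyperplanes W, LinearMap.ker (L H) = H)
    {w : V ≃ₗᵢ[ℂ] V} (hw : w ∈ W) {H : Submodule ℂ V}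
    (hH : H ∈ reflectingHyperplanes W) :
    ∃ c : ℂ, act b w (linearForm b (L H)) =
      c • linearForm b (L (H.map (w.toLinearEquiv : V →ₗ[ℂ] V))) := by
  obtain ⟨c, hc⟩ := exists_eq_smul_of_ker_le
    (ℓ := L (H.map (w.toLinearEquiv : V →ₗ[ℂ] V)))
    (ℓ' := (L H).comp (w⁻¹ : V ≃ₗᵢ[ℂ] V).toLinearEquiv.toLinearMap) (by
      rw [hL _ (map_mem_reflectingHyperplanes hw hH)]
      rintro _ ⟨u, hu, rfl⟩
      change L H (w.symm (w u)) = 0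
      rw [w.symm_apply_apply, ← LinearMap.mem_ker, hL H hH]
      exact hu)
  exact ⟨c, by rw [act_linearForm, hc, linearForm_smul]⟩

theorem not_dvd_of_ne
    (hL : ∀ H ∈ reflectingHyperplanes W, LinearMap.ker (L H) = H)
    {H H' : Submodule ℂ V} (hH : H ∈ reflectingHyperplanes W)
    (hH' : H' ∈ reflectingHyperplanes W) (hne : H ≠ H') :
    ¬ linearForm b (L H) ∣ linearForm b (L H') := by
  intro h
  refine hne ?_
  rw [← hL H hH, ← hL H' hH']
  exact exists_smul_of_linearForm_dvd b (ne_zero_of_mem_reflectingHyperplanes hH' (hL H' hH')) h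

variable [Finite W]

theorem discriminantForm_eq_prod : discriminantForm b W L =
    ∏ H ∈ (finite_reflectingHyperplanes W).toFinset,
      linearForm b (L H) ^ (Nat.card (pointwiseStabilizer W H) - 1) :=
  finprod_mem_eq_finite_toFinset_prod _ _

variable (W) in
/-- The degree `∑_H (e_H - 1)` of `Δ`. -/
def discriminantDegree : ℕ :=
  ∑ H ∈ (finite_reflectingHyperplanes W).toFinset, (Nat.card (pointwiseStabilizer W H) - 1)

theorem isHomogeneous_discriminantForm :
    (discriminantForm b W L).IsHomogeneous (discriminantDegree W) := by
  rw [discriminantForm_eq_prod]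
  refine IsHomogeneous.prod _ _ _ fun H _ => ?_
  have := (isHomogeneous_linearForm b (L H)).pow (Nat.card (pointwiseStabilizer W H) - 1)
  rwa [one_mul] at this

variable (hL : ∀ H ∈ reflectingHyperplanes W, LinearMap.ker (L H) = H)
include hL

theorem discriminantForm_ne_zero : discriminantForm b W L ≠ 0 := by
  rw [discriminantForm_eq_prod]
  refine Finset.prod_ne_zero_iff.mpr fun H hH => pow_ne_zero _ ?_
  rw [Set.Finite.mem_toFinset] at hH
  exact linearForm_ne_zero b (ne_zero_of_mem_reflectingHyperplanes hH (hL H hH))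

/-- `Δ` is a semi-invariant, with a unitary character. -/
theorem exists_act_discriminantForm_eq {w : V ≃ₗᵢ[ℂ] V} (hw : w ∈ W) :
    ∃ c : ℂ, ‖c‖ = 1 ∧ act b w (discriminantForm b W L) = c • discriminantForm b W L := by
  classical
  have h1 : ∃ c : ℂ, act b w (discriminantForm b W L) = c • discriminantForm b W L := by
    choose! c hc using fun H (hH : H ∈ reflectingHyperplanes W) =>
      act_linearForm_reflecting b hL hw hH
    let T := (finite_reflectingHyperplanes W).toFinset
    refine ⟨∏ H ∈ T, c H ^ (Nat.card (pointwiseStabilizer W H) - 1), ?_⟩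
    rw [discriminantForm_eq_prod, map_prod]
    -- `w` permutes the reflecting hyperplanes and preserves the orders `e_H`, so the product may be
    -- reindexed along `w`.
    have h2 : ∏ H ∈ T, linearForm b (L H) ^ (Nat.card (pointwiseStabilizer W H) - 1) =
        ∏ H ∈ T, linearForm b (L (H.map (w.toLinearEquiv : V →ₗ[ℂ] V))) ^
          (Nat.card (pointwiseStabilizer W H) - 1) := by
      refine Finset.prod_nbij'
        (fun H => H.map ((w⁻¹ : V ≃ₗᵢ[ℂ] V).toLinearEquiv : V →ₗ[ℂ] V))
        (fun H => H.map (w.toLinearEquiv : V →ₗ[ℂ] V)) ?_ ?_ ?_ ?_ ?_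
      · intro H hH
        rw [Set.Finite.mem_toFinset] at hH ⊢
        exact map_mem_reflectingHyperplanes (W.inv_mem hw) hH
      · intro H hH
        rw [Set.Finite.mem_toFinset] at hH ⊢
        exact map_mem_reflectingHyperplanes hw hH
      · intro H _
        exact map_map_inv w H
      · intro H _
        exact map_inv_map w H
      · intro H _
        rw [map_map_inv, card_pointwiseStabilizer_map (W.inv_mem hw)]
    change _ = _ • ∏ H ∈ T, _
    rw [h2, smul_eq_C_mul, map_prod, ← Finset.prod_mul_distrib]
    refine Finset.prod_congr rfl fun H hH => ?_
    rw [Set.Finite.mem_toFinset] at hH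
    rw [map_pow, hc H hH, smul_eq_C_mul, mul_pow, C_pow]
  obtain ⟨c, hc⟩ := h1
  refine ⟨c, ?_, hc⟩
  -- The scalar is a root of unity because `w` has finite order; hence its modulus is one.
  have h2 : w ^ Nat.card W = 1 := by
    have := pow_card_eq_one' (x := (⟨w, hw⟩ : W))
    exact congrArg Subtype.val this
  have h3 := act_pow_eq b hc (Nat.card W)
  rw [h2, act_one] at h3
  have h4 : (c ^ Nat.card W - 1) • discriminantForm b W L = 0 := by
    rw [sub_smul, ← h3, one_smul, sub_self]
  rcases smul_eq_zero.mp h4 with h | h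
  · exact Complex.norm_eq_one_of_pow_eq_one (sub_eq_zero.mp h) Nat.card_pos.ne'
  · exact absurd h (discriminantForm_ne_zero b hL)

theorem discriminantForm_eq_pow_mul {H : Submodule ℂ V} (hH : H ∈ reflectingHyperplanes W) :
    ∃ Q, discriminantForm b W L =
      linearForm b (L H) ^ (Nat.card (pointwiseStabilizer W H) - 1) * Q ∧
      ¬ linearForm b (L H) ∣ Q := by
  classical
  have hp := prime_linearForm b (ne_zero_of_mem_reflectingHyperplanes hH (hL H hH))
  rw [discriminantForm_eq_prod]
  refine ⟨_, (Finset.mul_prod_erase _ _ ((Set.Finite.mem_toFinset _).mpr hH)).symm, fun h => ?_⟩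
  obtain ⟨H', hH', h'⟩ := hp.exists_mem_finset_dvd h
  rw [Finset.mem_erase, Set.Finite.mem_toFinset] at hH'
  exact not_dvd_of_ne b hL hH hH'.2 hH'.1.symm (hp.dvd_of_dvd_pow h')

/-- Write `Δ = L_H^(e-1) Q` with `L_H ∤ Q`. If `sΔ = χΔ`, then `c^e = 1` gives `sQ = χc Q`, while
`sQ ≡ Q` modulo `L_H`. Hence `L_H` divides `(χc - 1) Q`, and `χ = c⁻¹`. -/
theorem act_discriminantForm_of_mem_stabilizer {H : Submodule ℂ V}
    (hH : H ∈ reflectingHyperplanes W) {s : V ≃ₗᵢ[ℂ] V} (hs : s ∈ pointwiseStabilizer W H)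
    {c : ℂ} (hc : act b s (linearForm b (L H)) = c • linearForm b (L H)) :
    c ≠ 0 ∧ act b s (discriminantForm b W L) = c⁻¹ • discriminantForm b W L := by
  have hℓ := ne_zero_of_mem_reflectingHyperplanes hH (hL H hH)
  have hp := prime_linearForm b hℓ
  have hce := pow_card_eq_one_of_act_linearForm b hs hℓ hc
  have hcard : 0 < Nat.card (pointwiseStabilizer W H) := Nat.card_pos
  have hc0 : c ≠ 0 := by
    rintro rfl
    rw [zero_pow hcard.ne'] at hce
    exact zero_ne_one hce
  refine ⟨hc0, ?_⟩
  obtain ⟨χ, _, hχ⟩ := exists_act_discriminantForm_eq b hL hs.1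
  obtain ⟨Q, hQ, hndvd⟩ := discriminantForm_eq_pow_mul b hL hH
  suffices χ * c = 1 by rw [hχ, eq_inv_of_mul_eq_one_left this]
  have h1 : act b s Q = (χ * c) • Q := by
    rw [hQ, map_mul, map_pow, hc, smul_pow, smul_mul_assoc] at hχ
    have h2 : linearForm b (L H) ^ (Nat.card (pointwiseStabilizer W H) - 1) *
        (c ^ (Nat.card (pointwiseStabilizer W H) - 1) • act b s Q) =
        linearForm b (L H) ^ (Nat.card (pointwiseStabilizer W H) - 1) * (χ • Q) := by
      rw [mul_smul_comm, mul_smul_comm, hχ]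
    have h3 := mul_left_cancel₀ (pow_ne_zero _ hp.ne_zero) h2
    rw [mul_comm, mul_smul, ← h3, smul_smul, ← pow_succ', Nat.sub_add_cancel hcard, hce, one_smul]
  have h2 := linearForm_dvd_act_sub b hs (hL H hH) Q
  by_contra hne
  rw [h1, ← one_smul ℂ Q, smul_smul, mul_one, ← sub_smul, smul_eq_C_mul] at h2
  rcases hp.dvd_or_dvd h2 with h | h
  · exact hp.not_isUnit (isUnit_of_dvd_unit h ((sub_ne_zero.mpr hne).isUnit.map C))
  · exact hndvd h

/-- A semi-invariant with the same character as `Δ` is divisible by `Δ`. -/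
theorem discriminantForm_dvd {f : MvPolynomial (Fin n) ℂ}
    (hf : ∀ w ∈ W, ∀ c : ℂ, act b w (discriminantForm b W L) = c • discriminantForm b W L →
      act b w f = c • f) : discriminantForm b W L ∣ f := by
  classical
  rw [discriminantForm_eq_prod]
  refine Finset.prod_dvd_of_isRelPrime ?_ ?_
  · intro H hH H' hH' hne
    simp only [Finset.mem_coe, Set.Finite.mem_toFinset] at hH hH'
    have hp := prime_linearForm b (ne_zero_of_mem_reflectingHyperplanes hH (hL H hH))
    exact (hp.irreducible.isRelPrime_iff_not_dvd.mpr (not_dvd_of_ne b hL hH hH' hne)).pow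
  · intro H hH
    rw [Set.Finite.mem_toFinset] at hH
    have hp := prime_linearForm b (ne_zero_of_mem_reflectingHyperplanes hH (hL H hH))
    -- If `f = L_H^k q` with `k + 1 < e_H`, choose `s` with `c^(k+1) ≠ 1`. From `sf = c⁻¹ f` comes
    -- `c^(k+1) sq = q`, and `sq ≡ q` modulo `L_H`; so `L_H` divides `(c^(k+1) - 1) q`, hence `q`.
    have key : ∀ k, k ≤ Nat.card (pointwiseStabilizer W H) - 1 → linearForm b (L H) ^ k ∣ f := by
      intro k
      induction k with
      | zero => intro _; simp
      | succ k ih =>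
        intro hk
        obtain ⟨q, hq⟩ := ih (by omega)
        obtain ⟨s, hs, c, hc, hck⟩ := exists_pow_ne_one_of_lt b (W := W) (hL H hH)
          (Nat.succ_pos k) (by omega)
        obtain ⟨hc0, hsΔ⟩ := act_discriminantForm_of_mem_stabilizer b hL hH hs hc
        have h1 := hf s hs.1 _ hsΔ
        rw [hq, map_mul, map_pow, hc, smul_pow, smul_mul_assoc] at h1
        have h2 : linearForm b (L H) ^ k * (c ^ (k + 1) • act b s q) =
            linearForm b (L H) ^ k * q := by
          rw [mul_smul_comm, pow_succ', mul_smul, h1, smul_smul, mul_inv_cancel₀ hc0, one_smul]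
        have h3 := mul_left_cancel₀ (pow_ne_zero _ hp.ne_zero) h2
        have h4 := linearForm_dvd_act_sub b hs (hL H hH) q
        have h5 : linearForm b (L H) ∣ C (c ^ (k + 1) - 1) * q := by
          have : C (c ^ (k + 1) - 1) * q = - (C (c ^ (k + 1)) * (act b s q - q)) := by
            rw [mul_sub, ← smul_eq_C_mul (act b s q), h3, C_sub, sub_mul, C_1, one_mul, neg_sub]
          rw [this]
          exact (h4.mul_left _).neg_right
        rcases hp.dvd_or_dvd h5 with h | ⟨r, hr⟩
        · exact absurd (isUnit_of_dvd_unit h ((sub_ne_zero.mpr hck).isUnit.map C)) hp.not_isUnit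
        · exact ⟨r, by rw [hq, hr, pow_succ, mul_assoc]⟩
    exact key _ le_rfl

/-- A nonzero multiple of `Δ` has degree at least `deg Δ`. The bound is imposed on each monomial, so
`f` need not be homogeneous. -/
theorem eq_zero_of_semiinvariant_of_lt {f : MvPolynomial (Fin n) ℂ}
    (hk : ∀ m, coeff m f ≠ 0 → m.degree < discriminantDegree W)
    (hf : ∀ w ∈ W, ∀ c : ℂ, act b w (discriminantForm b W L) = c • discriminantForm b W L →
      act b w f = c • f) : f = 0 := by
  by_contra h0
  obtain ⟨q, hq⟩ := discriminantForm_dvd b hL hf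
  have hΔ := discriminantForm_ne_zero b hL
  have hq0 : q ≠ 0 := by
    rintro rfl
    exact h0 (by rw [hq, mul_zero])
  have h1 := totalDegree_mul_of_isDomain hΔ hq0
  rw [← hq, (isHomogeneous_discriminantForm b).totalDegree hΔ] at h1
  obtain ⟨m, hm, hm'⟩ := Finset.exists_mem_eq_sup f.support (support_nonempty.mpr h0)
    fun s => s.sum fun _ e => e
  have h2 := hk m (mem_support_iff.mp hm)
  change f.totalDegree = m.degree at hm'
  omega

end Discriminant

/-! ### The coinvariant ideal is the annihilator of `Δ` -/

section Coinvariants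

variable {n : ℕ} {V : Type*} [NormedAddCommGroup V] [InnerProductSpace ℂ V]
  (b : OrthonormalBasis (Fin n) ℂ V) (W : Subgroup (V ≃ₗᵢ[ℂ] V))

/-- The ideal of `S` generated by the invariants without constant term. -/
def coinvariantIdeal : Ideal (MvPolynomial (Fin n) ℂ) :=
  Ideal.span {p | p ∈ invariants b W ∧ constantCoeff p = 0}

variable {W}

theorem mem_coinvariantIdeal {p : MvPolynomial (Fin n) ℂ} (hp : p ∈ invariants b W)
    (h0 : constantCoeff p = 0) : p ∈ coinvariantIdeal b W :=
  Ideal.subset_span ⟨hp, h0⟩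

theorem smul_mem_coinvariantIdeal {p : MvPolynomial (Fin n) ℂ} (c : ℂ)
    (hp : p ∈ coinvariantIdeal b W) : c • p ∈ coinvariantIdeal b W :=
  Submodule.smul_of_tower_mem _ c hp

theorem coinvariantIdeal_induction {P : MvPolynomial (Fin n) ℂ → Prop}
    (hmul : ∀ q p, p ∈ invariants b W → constantCoeff p = 0 → P (q * p)) (hzero : P 0)
    (hadd : ∀ x y, P x → P y → P (x + y))
    {i : MvPolynomial (Fin n) ℂ} (hi : i ∈ coinvariantIdeal b W) : P i := by
  refine Submodule.closure_induction (p := fun x _ => P x) hzero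
    (fun x y _ _ hx hy => hadd x y hx hy) (fun q p hp => ?_) hi
  exact hmul q p hp.1 hp.2

theorem act_mem_coinvariantIdeal {w : V ≃ₗᵢ[ℂ] V} (hw : w ∈ W) {i : MvPolynomial (Fin n) ℂ}
    (hi : i ∈ coinvariantIdeal b W) : act b w i ∈ coinvariantIdeal b W := by
  refine coinvariantIdeal_induction b (P := fun i => act b w i ∈ coinvariantIdeal b W)
    (fun q p hp h0 => ?_) ?_ (fun x y hx hy => ?_) hi
  · rw [map_mul, hp w hw]
    exact Ideal.mul_mem_left _ _ (mem_coinvariantIdeal b hp h0)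
  · rw [map_zero]
    exact Ideal.zero_mem _
  · rw [map_add]
    exact Ideal.add_mem _ hx hy

/-- For a generator multiple `q p` with `p` invariant, `s(qp) - qp = (sq - q) p`; dividing `sq - q`
by `ℓ` leaves the factor `p` intact. -/
theorem exists_act_sub_eq_linearForm_mul {H : Submodule ℂ V} {ℓ : Module.Dual ℂ V}
    (hℓ : LinearMap.ker ℓ = H) {s : V ≃ₗᵢ[ℂ] V} (hs : s ∈ pointwiseStabilizer W H)
    {i : MvPolynomial (Fin n) ℂ} (hi : i ∈ coinvariantIdeal b W) :
    ∃ j ∈ coinvariantIdeal b W, act b s i - i = linearForm b ℓ * j := by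
  refine coinvariantIdeal_induction b
    (P := fun i => ∃ j ∈ coinvariantIdeal b W, act b s i - i = linearForm b ℓ * j)
    (fun q p hp h0 => ?_) ?_ ?_ hi
  · obtain ⟨t, ht⟩ := linearForm_dvd_act_sub b hs hℓ q
    refine ⟨t * p, Ideal.mul_mem_left _ _ (mem_coinvariantIdeal b hp h0), ?_⟩
    rw [map_mul, hp s hs.1, ← sub_mul, ht, mul_assoc]
  · exact ⟨0, Ideal.zero_mem _, by simp⟩
  · rintro x y ⟨j, hj, hx⟩ ⟨k, hk, hy⟩
    refine ⟨j + k, Ideal.add_mem _ hj hk, ?_⟩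
    rw [map_add, add_sub_add_comm, hx, hy, mul_add]

section Finite

variable [Finite W]

variable (W) in
/-- The maximal ideal of `S` at the origin is nilpotent modulo the coinvariant ideal. -/
theorem exists_pow_le_coinvariantIdeal :
    ∃ M, (Ideal.span (Set.range (X : Fin n → MvPolynomial (Fin n) ℂ))) ^ M ≤
      coinvariantIdeal b W := by
  classical
  have := Fintype.ofFinite W
  refine Ideal.exists_pow_le_of_le_radical_of_fg ?_
    (Submodule.fg_span (Set.finite_range _))
  rw [Ideal.span_le]
  rintro _ ⟨i, rfl⟩
  -- The orbit polynomial of `xᵢ` has invariant coefficients, and at the origin it becomes `T^|W|`,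
  -- so its lower coefficients lie in the ideal. Evaluating at its root `xᵢ` gives `xᵢ^|W| ∈ I`.
  let P : Polynomial (MvPolynomial (Fin n) ℂ) :=
    ∏ w : W, (Polynomial.X - Polynomial.C (act b w.1 (X i)))
  have hPact : ∀ u ∈ W, P.map (act b u).toRingHom = P := by
    intro u hu
    rw [Polynomial.map_prod]
    refine Fintype.prod_equiv (Equiv.mulLeft (⟨u, hu⟩ : W))
      (fun w : W => Polynomial.map (act b u).toRingHom
        (Polynomial.X - Polynomial.C (act b w.1 (X i))))
      (fun w : W => Polynomial.X - Polynomial.C (act b w.1 (X i))) fun w => ?_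
    have h1 : act b (Equiv.mulLeft (⟨u, hu⟩ : W) w).1 (X i) =
        (act b u).toRingHom (act b w.1 (X i)) := act_mul b u w.1 (X i)
    rw [Polynomial.map_sub, Polynomial.map_X, Polynomial.map_C, h1]
  have hP0 : P.map (constantCoeff : MvPolynomial (Fin n) ℂ →+* ℂ) =
      Polynomial.X ^ Fintype.card W := by
    rw [Polynomial.map_prod]
    simp [constantCoeff_act]
  have hmonic : P.Monic := Polynomial.monic_prod_of_monic _ _ fun w _ => Polynomial.monic_X_sub_C _
  have hdeg : P.natDegree = Fintype.card W := by
    rw [Polynomial.natDegree_prod_of_monic _ _ fun w _ => Polynomial.monic_X_sub_C _]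
    simp
  have hroot : P.eval (X i) = 0 := by
    rw [Polynomial.eval_prod]
    refine Finset.prod_eq_zero (Finset.mem_univ 1) ?_
    simp [act_one]
  refine ⟨Fintype.card W, ?_⟩
  rw [Polynomial.eval_eq_sum_range, hdeg, Finset.sum_range_succ] at hroot
  have hlead : P.coeff (Fintype.card W) = 1 := by rw [← hdeg]; exact hmonic
  rw [hlead, one_mul] at hroot
  rw [eq_neg_of_add_eq_zero_right hroot]
  refine (Ideal.neg_mem_iff _).mpr (Ideal.sum_mem _ fun k hk => ?_)
  refine Ideal.mul_mem_right _ _ (mem_coinvariantIdeal b (fun u hu => ?_) ?_)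
  · conv_rhs => rw [← hPact u hu]
    rw [Polynomial.coeff_map]
    rfl
  · rw [← Polynomial.coeff_map, hP0, Polynomial.coeff_X_pow, if_neg]
    exact (Finset.mem_range.mp hk).ne

variable {L : Submodule ℂ V → Module.Dual ℂ V}
  (hL : ∀ H ∈ reflectingHyperplanes W, LinearMap.ker (L H) = H)
include hL

theorem starOp_discriminantForm_eq_zero_of_invariant {p : MvPolynomial (Fin n) ℂ}
    (hp : p ∈ invariants b W) (h0 : constantCoeff p = 0) :
    starOp p (discriminantForm b W L) = 0 := by
  refine eq_zero_of_semiinvariant_of_lt b hL (fun m hm => ?_) fun w hw c hc => ?_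
  · rw [starOp, LinearMap.sum_apply, coeff_sum] at hm
    obtain ⟨a, ha, hne⟩ := Finset.exists_ne_zero_of_sum_ne_zero hm
    rw [LinearMap.smul_apply, coeff_smul, coeff_diffMonomial] at hne
    have h1 : coeff (m + a) (discriminantForm b W L) ≠ 0 := fun h0 => hne (by simp [h0])
    have h2 := degree_of_isHomogeneous (isHomogeneous_discriminantForm b) h1
    have h3 : a ≠ 0 := by
      rintro rfl
      exact mem_support_iff.mp ha h0
    have h4 : a.degree ≠ 0 := fun h => h3 ((Finsupp.degree_eq_zero_iff a).mp h)
    rw [map_add] at h2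
    omega
  · rw [act_starOp, hp w hw, hc, map_smul]

theorem starOp_discriminantForm_eq_zero_of_mem {i : MvPolynomial (Fin n) ℂ}
    (hi : i ∈ coinvariantIdeal b W) : starOp i (discriminantForm b W L) = 0 := by
  refine coinvariantIdeal_induction b (P := fun i => starOp i (discriminantForm b W L) = 0)
    (fun q p hp h0 => ?_) ?_ (fun x y hx hy => ?_) hi
  · rw [starOp_mul_apply, starOp_discriminantForm_eq_zero_of_invariant b hL hp h0, map_zero]
  · rw [starOp_zero, LinearMap.zero_apply]
  · rw [starOp_add, LinearMap.add_apply, hx, hy, add_zero]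

/-- A polynomial that transforms like `Δ` modulo the coinvariant ideal and annihilates `Δ` lies in
the coinvariant ideal. -/
theorem mem_coinvariantIdeal_of_semiinvariant {f : MvPolynomial (Fin n) ℂ}
    (hf : ∀ w ∈ W, ∃ c : ℂ, act b w (discriminantForm b W L) = c • discriminantForm b W L ∧
      act b w f - c • f ∈ coinvariantIdeal b W)
    (h0 : starOp f (discriminantForm b W L) = 0) : f ∈ coinvariantIdeal b W := by
  classical
  have := Fintype.ofFinite W
  set Δ := discriminantForm b W L with hΔdef
  have hΔ : Δ ≠ 0 := discriminantForm_ne_zero b hL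
  have huniq : ∀ {c d : ℂ}, c • Δ = d • Δ → c = d := fun h => smul_left_injective ℂ hΔ h
  choose χ hχ hfχ using fun w : W => hf w.1 w.2
  have hχ0 : ∀ w, χ w ≠ 0 := fun w h => by
    have h1 := hχ w
    rw [h, zero_smul] at h1
    exact hΔ (by rw [← act_inv_act b w.1 Δ, h1, map_zero])
  -- Averaging against the character of `Δ` gives a true semi-invariant that agrees with `|W| f`
  -- modulo the ideal. It is then `Δ g` with `g` invariant, hence congruent to `g(0) Δ`.
  let F := ∑ w : W, (χ w)⁻¹ • act b w.1 f
  have hF : ∀ u ∈ W, ∀ c : ℂ, act b u Δ = c • Δ → act b u F = c • F := by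
    intro u hu c hc
    rw [map_sum, Finset.smul_sum]
    refine Fintype.sum_equiv (Equiv.mulLeft (⟨u, hu⟩ : W))
      (fun w : W => act b u ((χ w)⁻¹ • act b w.1 f))
      (fun w : W => c • (χ w)⁻¹ • act b w.1 f) fun w => ?_
    have hmul : ∀ p, act b (⟨u, hu⟩ * w : W).1 p = act b u (act b w.1 p) :=
      fun p => act_mul b u w.1 p
    have h1 : χ (⟨u, hu⟩ * w) = χ w * c := huniq (by
      rw [← hχ, hmul, hχ w, map_smul, hc, smul_smul])
    have hc0 : c ≠ 0 := fun h => hχ0 (⟨u, hu⟩ * w) (by rw [h1, h, mul_zero])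
    rw [Equiv.coe_mulLeft, h1, map_smul, smul_smul, mul_inv_rev, mul_inv_cancel_left₀ hc0, hmul]
  have hFf : F - (Fintype.card W : ℂ) • f ∈ coinvariantIdeal b W := by
    have : F - (Fintype.card W : ℂ) • f = ∑ w : W, (χ w)⁻¹ • (act b w.1 f - χ w • f) := by
      simp only [smul_sub, smul_smul, inv_mul_cancel₀ (hχ0 _), one_smul, Finset.sum_sub_distrib]
      simp [F, Nat.cast_smul_eq_nsmul]
    rw [this]
    exact Ideal.sum_mem _ fun w _ => smul_mem_coinvariantIdeal b _ (hfχ w)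
  obtain ⟨g, hg⟩ := discriminantForm_dvd b hL hF
  have hgR : g ∈ invariants b W := by
    intro u hu
    obtain ⟨c, hc1, hc⟩ := exists_act_discriminantForm_eq b hL hu
    have h1 := hF u hu c hc
    have hc0 : c ≠ 0 := norm_ne_zero_iff.mp (hc1.symm ▸ one_ne_zero)
    rw [hg, map_mul, hc, smul_mul_assoc] at h1
    exact mul_left_cancel₀ hΔ (smul_right_injective _ hc0 h1)
  have hgI : g - C (constantCoeff g) ∈ coinvariantIdeal b W :=
    mem_coinvariantIdeal b (Subalgebra.sub_mem _ hgR
      (Subalgebra.algebraMap_mem (invariants b W) (constantCoeff g))) (by simp)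
  have hcard : (Fintype.card W : ℂ) ≠ 0 := Nat.cast_ne_zero.mpr Fintype.card_ne_zero
  have hFI : F - constantCoeff g • Δ ∈ coinvariantIdeal b W := by
    have : F - constantCoeff g • Δ = Δ * (g - C (constantCoeff g)) := by
      rw [hg, smul_eq_C_mul]; ring
    rw [this]
    exact Ideal.mul_mem_left _ _ hgI
  have hF0 : starOp F Δ = 0 := by
    have := starOp_discriminantForm_eq_zero_of_mem b hL hFf
    rwa [starOp_sub, LinearMap.sub_apply, starOp_smul_apply, h0, smul_zero, sub_zero] at this
  -- Both `F` and elements of the ideal annihilate `Δ`, whereas `Δ^* Δ` has value `⟨Δ, Δ⟩ ≠ 0` at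
  -- the origin.
  have hg0 : constantCoeff g = 0 := by
    have h1 := starOp_discriminantForm_eq_zero_of_mem b hL hFI
    rw [starOp_sub, LinearMap.sub_apply, hF0, zero_sub, neg_eq_zero, starOp_smul_apply] at h1
    rcases smul_eq_zero.mp h1 with h | h
    · simpa using h
    · refine absurd (pairing_self_eq_zero (f := Δ) ?_) hΔ
      rw [pairing, h, map_zero]
  rw [hg0, zero_smul, sub_zero] at hFI
  have h1 := Ideal.sub_mem _ hFI hFf
  rw [sub_sub_cancel] at h1
  have h2 := smul_mem_coinvariantIdeal b (Fintype.card W : ℂ)⁻¹ h1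
  rwa [inv_smul_smul₀ hcard] at h2

/-- The annihilator of `Δ` is the coinvariant ideal. -/
theorem mem_coinvariantIdeal_of_starOp_eq_zero (hW : IsReflectionGroup W)
    {f : MvPolynomial (Fin n) ℂ} (h0 : starOp f (discriminantForm b W L) = 0) :
    f ∈ coinvariantIdeal b W := by
  obtain ⟨M, hM⟩ := exists_pow_le_coinvariantIdeal b W
  set 𝔪 : Ideal (MvPolynomial (Fin n) ℂ) := Ideal.span (Set.range X) with h𝔪
  -- Descending induction on the power `k` of the maximal ideal, starting at `𝔪^M ⊆ I`.
  suffices key : ∀ d k, k + d = M → ∀ f ∈ 𝔪 ^ k, starOp f (discriminantForm b W L) = 0 →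
      f ∈ coinvariantIdeal b W from
    key M 0 (zero_add M) f (by simp) h0
  intro d
  induction d with
  | zero =>
    intro k hk f hf _
    rw [← hk] at hM
    exact hM hf
  | succ d ih =>
    intro k hk f hf h0
    refine mem_coinvariantIdeal_of_semiinvariant b hL (fun w hw => ?_) h0
    rw [← hW] at hw
    induction hw using Subgroup.closure_induction with
    | mem s hs =>
      have hH : fixedSpace s ∈ reflectingHyperplanes W := ⟨s, hs, rfl⟩
      have hℓ := hL _ hH
      have hℓ0 := ne_zero_of_mem_reflectingHyperplanes hH hℓ
      have hst : s ∈ pointwiseStabilizer W (fixedSpace s) := ⟨hs.1, fun v hv => hv⟩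
      obtain ⟨c, hc⟩ := exists_act_linearForm_eq b hst hℓ
      obtain ⟨hc0, hΔ⟩ := act_discriminantForm_of_mem_stabilizer b hL hH hst hc
      refine ⟨c⁻¹, hΔ, ?_⟩
      -- `L_H f` also annihilates `Δ` and lies one power deeper, so it is in `I` by induction.
      -- Cancelling `L_H` from `s(L_H f) - L_H f ∈ L_H I` gives `sf ≡ c⁻¹ f` modulo `I`, which is
      -- how `s` acts on `Δ`.
      have hmem : linearForm b (L (fixedSpace s)) * f ∈ coinvariantIdeal b W := by
        refine ih (k + 1) (by omega) _ ?_ ?_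
        · rw [pow_succ']
          refine Ideal.mul_mem_mul ?_ hf
          exact Ideal.sum_mem _ fun j _ =>
            Ideal.mul_mem_left _ _ (Ideal.subset_span ⟨j, rfl⟩)
        · rw [starOp_mul_apply, h0, map_zero]
      obtain ⟨j, hj, hj'⟩ := exists_act_sub_eq_linearForm_mul b hℓ hst hmem
      rw [map_mul, hc, smul_mul_assoc, ← mul_smul_comm, ← mul_sub] at hj'
      have h1 := mul_left_cancel₀ (linearForm_ne_zero b hℓ0) hj'
      have h2 := smul_mem_coinvariantIdeal b c⁻¹ hj
      rwa [← h1, smul_sub, inv_smul_smul₀ hc0] at h2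
    | one =>
      refine ⟨1, by rw [act_one, one_smul], ?_⟩
      rw [act_one, one_smul, sub_self]
      exact zero_mem _
    | mul u v hu hv ihu ihv =>
      rw [hW] at hu hv
      obtain ⟨c, hc, hcf⟩ := ihu
      obtain ⟨d, hd, hdf⟩ := ihv
      refine ⟨d * c, by rw [act_mul, hd, map_smul, hc, smul_smul], ?_⟩
      have : act b (u * v) f - (d * c) • f = act b u (act b v f - d • f) +
          d • (act b u f - c • f) := by
        rw [act_mul, map_sub, map_smul, smul_sub, smul_smul]; ring
      rw [this]
      exact Ideal.add_mem _ (act_mem_coinvariantIdeal b hu hdf) (smul_mem_coinvariantIdeal b _ hcf)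
    | inv u hu ihu =>
      rw [hW] at hu
      obtain ⟨c, hc, hcf⟩ := ihu
      have hc0 : c ≠ 0 := by
        rintro rfl
        rw [zero_smul] at hc
        refine discriminantForm_ne_zero b hL ?_
        rw [← act_inv_act b u (discriminantForm b W L), hc, map_zero]
      refine ⟨c⁻¹, act_inv_eq b hc0 hc, ?_⟩
      have h1 := smul_mem_coinvariantIdeal b (-c⁻¹)
        (act_mem_coinvariantIdeal b (W.inv_mem hu) hcf)
      rw [map_sub, act_inv_act, map_smul, smul_sub, smul_smul, neg_mul, inv_mul_cancel₀ hc0] at h1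
      convert h1 using 1
      rw [neg_smul, neg_smul, one_smul]; ring

end Finite

end Coinvariants

/-! ### The polynomials `∑ⱼ xⱼ φ(∂ⱼ h)` -/

section Canonical

variable {n : ℕ}

/-- The polynomial `∑ⱼ xⱼ φ(∂ⱼ h)`. -/
def canonicalPoly (Δ h : MvPolynomial (Fin n) ℂ) : MvPolynomial (Fin n) ℂ :=
  ∑ j, X j * phi Δ (pderiv j h)

theorem canonicalPoly_sum_smul {ι : Type*} (s : Finset ι) (Δ : MvPolynomial (Fin n) ℂ) (c : ι → ℂ)
    (h : ι → MvPolynomial (Fin n) ℂ) :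
    canonicalPoly Δ (∑ i ∈ s, c i • h i) = ∑ i ∈ s, c i • canonicalPoly Δ (h i) := by
  simp only [canonicalPoly, map_sum, Derivation.map_smul, phi_sum, phi_smul, Finset.mul_sum,
    Finset.smul_sum, mul_smul_comm]
  exact Finset.sum_comm

theorem isHomogeneous_canonicalPoly {Δ h : MvPolynomial (Fin n) ℂ} {N d : ℕ}
    (hΔ : Δ.IsHomogeneous N) (hd : 0 < d) (hh : h.IsHomogeneous d) :
    (canonicalPoly Δ h).IsHomogeneous d := by
  refine IsHomogeneous.sum _ _ _ fun j _ => ?_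
  have := (isHomogeneous_X ℂ j).mul (isHomogeneous_phi (hh.pderiv (i := j)) hΔ)
  rwa [Nat.add_sub_cancel' hd] at this

theorem pairing_canonicalPoly (Δ h : MvPolynomial (Fin n) ℂ) :
    pairing h (canonicalPoly Δ h) =
      ∑ j, pairing (starOp (pderiv j h) Δ) (starOp (pderiv j h) Δ) := by
  rw [canonicalPoly, pairing_sum_right]
  exact Finset.sum_congr rfl fun j _ => by rw [pairing_X_mul_right, pairing_phi_self]

theorem starOp_pderiv_eq_zero_of_canonicalPoly_eq_zero {Δ h : MvPolynomial (Fin n) ℂ}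
    (h0 : canonicalPoly Δ h = 0) (j : Fin n) : starOp (pderiv j h) Δ = 0 := by
  have h1 := pairing_canonicalPoly Δ h
  rw [h0, pairing, map_zero, map_zero] at h1
  have h2 := congrArg Complex.re h1.symm
  rw [Complex.re_sum, Complex.zero_re,
    Finset.sum_eq_zero_iff_of_nonneg fun j _ => pairing_self_nonneg _] at h2
  refine pairing_self_eq_zero (Complex.ext (h2 j (Finset.mem_univ j)) ?_)
  exact Complex.conj_eq_iff_im.mp (pairing_conj_symm _ _)

variable {V : Type*} [NormedAddCommGroup V] [InnerProductSpace ℂ V]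
  (b : OrthonormalBasis (Fin n) ℂ V)

/-- Coordinates transform by the matrix of `w` and derivatives by its conjugate, so by unitarity
contracting one against the other is invariant. -/
theorem sum_actMatrix_mul (w : V ≃ₗᵢ[ℂ] V) (A B : Fin n → MvPolynomial (Fin n) ℂ) :
    ∑ j, (∑ k, starRingEnd ℂ (actMatrix b w j k) • A k) * (∑ l, actMatrix b w j l • B l) =
      ∑ k, A k * B k := by
  have h1 : ∀ j, (∑ k, starRingEnd ℂ (actMatrix b w j k) • A k) *
      (∑ l, actMatrix b w j l • B l) =
      ∑ k, ∑ l, (starRingEnd ℂ (actMatrix b w j k) * actMatrix b w j l) • (A k * B l) := fun j => by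
    rw [Finset.sum_mul_sum]
    simp only [smul_mul_smul_comm]
  simp only [h1]
  rw [Finset.sum_comm]
  refine Finset.sum_congr rfl fun k _ => ?_
  rw [Finset.sum_comm]
  simp only [← Finset.sum_smul, actMatrix_col, ite_smul, one_smul, zero_smul]
  simp

variable {W : Subgroup (V ≃ₗᵢ[ℂ] V)} [Finite W] {L : Submodule ℂ V → Module.Dual ℂ V}

/-- `Δ` enters `φ` once linearly and once conjugate-linearly, so the character contributes `c · conj
c = 1`. -/
theorem act_phi {w : V ≃ₗᵢ[ℂ] V} {Δ : MvPolynomial (Fin n) ℂ} {c : ℂ} (hc1 : ‖c‖ = 1)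
    (hc : act b w Δ = c • Δ) (f : MvPolynomial (Fin n) ℂ) :
    act b w (phi Δ f) = phi Δ (act b w f) := by
  rw [phi, act_starOp, act_starOp, hc, map_smul, map_smul, starOp_smul_apply, smul_smul,
    Complex.mul_conj, Complex.normSq_eq_norm_sq, hc1]
  simp [phi]

variable (hL : ∀ H ∈ reflectingHyperplanes W, LinearMap.ker (L H) = H)
include hL

theorem canonicalPoly_mem_invariants {h : MvPolynomial (Fin n) ℂ} (hh : h ∈ invariants b W) :
    canonicalPoly (discriminantForm b W L) h ∈ invariants b W := by
  intro w hw
  obtain ⟨c, hc1, hc⟩ := exists_act_discriminantForm_eq b hL hw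
  have h1 : ∀ j, act b w (X j * phi (discriminantForm b W L) (pderiv j h)) =
      (∑ k, starRingEnd ℂ (actMatrix b w j k) • phi (discriminantForm b W L) (pderiv k h)) *
        ∑ l, actMatrix b w j l • X l := fun j => by
    rw [map_mul, mul_comm, act_phi b hc1 hc, act_X, act_pderiv, hh w hw, phi_sum]
    simp only [phi_smul]
    simp only [smul_eq_C_mul]
  rw [canonicalPoly, map_sum]
  simp only [h1]
  rw [sum_actMatrix_mul]
  simp only [mul_comm]

/-- Because `p^* Δ = 0`, the operator `p^*` kills the image of `φ`, and only its commutators with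
the `xⱼ` survive. -/
theorem starOp_canonicalPoly {p h : MvPolynomial (Fin n) ℂ} (hp : p ∈ invariants b W)
    (hp0 : constantCoeff p = 0) :
    starOp p (canonicalPoly (discriminantForm b W L) h) =
      starOp (∑ j, pderiv j p * starOp (pderiv j h) (discriminantForm b W L))
        (discriminantForm b W L) := by
  rw [canonicalPoly, map_sum, starOp_sum, LinearMap.sum_apply]
  refine Finset.sum_congr rfl fun j _ => ?_
  have h1 : starOp p (phi (discriminantForm b W L) (pderiv j h)) = 0 := by
    rw [phi, ← starOp_mul_apply, mul_comm, starOp_mul_apply,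
      starOp_discriminantForm_eq_zero_of_invariant b hL hp hp0, map_zero]
  rw [starOp_X_mul, h1, mul_zero, zero_add, phi, starOp_mul_apply]

theorem sum_pderiv_mul_starOp_eq_zero {p h : MvPolynomial (Fin n) ℂ} {k d : ℕ}
    (hp : p ∈ invariants b W) (hh : h ∈ invariants b W) (hk : 0 < k) (hkd : k < d)
    (hpk : p.IsHomogeneous k) (hhd : h.IsHomogeneous d) :
    ∑ j, pderiv j p * starOp (pderiv j h) (discriminantForm b W L) = 0 := by
  have hΔ := isHomogeneous_discriminantForm b (W := W) (L := L)
  refine eq_zero_of_semiinvariant_of_lt b hL (fun m hm => ?_) fun w hw c hc => ?_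
  · rw [coeff_sum] at hm
    obtain ⟨j, -, hj⟩ := Finset.exists_ne_zero_of_sum_ne_zero hm
    -- Each nonzero term has degree `(k - 1) + (N - (d - 1))`, which is below `N = deg Δ` since `k <
    -- d`. If `d - 1 > N` the derivative of `h` already kills `Δ`.
    rcases le_or_gt (d - 1) (discriminantDegree W) with hle | hlt
    · have h1 := hpk.pderiv (i := j) |>.mul
        (isHomogeneous_starOp (Nat.sub_add_cancel hle) (hhd.pderiv (i := j)) hΔ)
      have h2 := degree_of_isHomogeneous h1 hj
      omega
    · rw [starOp_eq_zero_of_lt hlt (hhd.pderiv (i := j)) hΔ, mul_zero, coeff_zero] at hj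
      exact absurd rfl hj
  · have h1 : ∀ j, act b w (pderiv j p * starOp (pderiv j h) (discriminantForm b W L)) =
        c • ((∑ k, starRingEnd ℂ (actMatrix b w j k) • pderiv k p) *
          ∑ l, actMatrix b w j l • starOp (pderiv l h) (discriminantForm b W L)) := fun j => by
      rw [map_mul, act_starOp, act_pderiv, act_pderiv, hp w hw, hh w hw, hc, map_smul, starOp_sum,
        LinearMap.sum_apply, mul_smul_comm]
      simp only [starOp_smul_apply, Complex.conj_conj]
    rw [map_sum]
    simp only [h1]
    rw [← Finset.smul_sum, sum_actMatrix_mul]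

/-- Invariants without constant term map `∑ⱼ xⱼ φ(∂ⱼ h)` to constants. -/
theorem starOp_canonicalPoly_eq_C {p h : MvPolynomial (Fin n) ℂ} {k d : ℕ}
    (hp : p ∈ invariants b W) (hh : h ∈ invariants b W) (hk : 0 < k) (hd : 0 < d)
    (hpk : p.IsHomogeneous k) (hhd : h.IsHomogeneous d) :
    ∃ c, starOp p (canonicalPoly (discriminantForm b W L) h) = C c := by
  have hp0 : constantCoeff p = 0 := by
    rw [constantCoeff_eq]
    exact hpk.coeff_eq_zero (by simpa using hk.ne)
  rcases lt_or_ge k d with hkd | hkd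
  · refine ⟨0, ?_⟩
    rw [starOp_canonicalPoly b hL hp hp0,
      sum_pderiv_mul_starOp_eq_zero b hL hp hh hk hkd hpk hhd, starOp_zero, C_0]
    rfl
  · rcases hkd.eq_or_lt with rfl | hlt
    · have h1 := isHomogeneous_starOp (zero_add _) hpk
        (isHomogeneous_canonicalPoly (isHomogeneous_discriminantForm b (W := W) (L := L)) hd hhd)
      exact ⟨_, totalDegree_eq_zero_iff_eq_C.mp
        ((totalDegree_zero_iff_isHomogeneous _).mpr h1)⟩
    · refine ⟨0, ?_⟩
      rw [C_0]
      exact starOp_eq_zero_of_lt hlt hpk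
        (isHomogeneous_canonicalPoly (isHomogeneous_discriminantForm b) hd hhd)

end Canonical

/-! ### Decomposable invariants -/

section Decomposable

variable {n : ℕ} {V : Type*} [NormedAddCommGroup V] [InnerProductSpace ℂ V]
  (b : OrthonormalBasis (Fin n) ℂ V) (W : Subgroup (V ≃ₗᵢ[ℂ] V))

/-- The span of the products of two invariants without constant term. -/
def decomposables : Submodule ℂ (MvPolynomial (Fin n) ℂ) :=
  Submodule.span ℂ {x | ∃ p q, p ∈ invariants b W ∧ constantCoeff p = 0 ∧
    q ∈ invariants b W ∧ constantCoeff q = 0 ∧ x = p * q}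

/-! ### Averaging over `W`. -/

section Reynolds

variable [Finite W]

/-- The projection of `S` onto the invariants. -/
def reynolds : MvPolynomial (Fin n) ℂ →ₗ[ℂ] MvPolynomial (Fin n) ℂ :=
  letI := Fintype.ofFinite W
  (Fintype.card W : ℂ)⁻¹ • ∑ w : W, (act b w.1).toLinearMap

theorem reynolds_apply [Fintype W] (f : MvPolynomial (Fin n) ℂ) :
    reynolds b W f = (Fintype.card W : ℂ)⁻¹ • ∑ w : W, act b w.1 f := by
  rw [reynolds, LinearMap.smul_apply, LinearMap.sum_apply]
  congr!

variable {W}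

theorem reynolds_mem_invariants (f : MvPolynomial (Fin n) ℂ) :
    reynolds b W f ∈ invariants b W := by
  have := Fintype.ofFinite W
  intro u hu
  have h1 : ∑ w : W, act b u (act b w.1 f) = ∑ w : W, act b w.1 f := by
    refine Fintype.sum_equiv (Equiv.mulLeft (⟨u, hu⟩ : W)) (fun w : W => act b u (act b w.1 f))
      (fun w : W => act b w.1 f) fun w => ?_
    have hmul : ∀ p, act b (⟨u, hu⟩ * w : W).1 p = act b u (act b w.1 p) :=
      fun p => act_mul b u w.1 p
    rw [Equiv.coe_mulLeft, hmul]
  rw [reynolds_apply, map_smul, map_sum, h1]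

theorem constantCoeff_reynolds {f : MvPolynomial (Fin n) ℂ} (h0 : constantCoeff f = 0) :
    constantCoeff (reynolds b W f) = 0 := by
  have := Fintype.ofFinite W
  rw [reynolds_apply, smul_eq_C_mul, map_mul, map_sum]
  simp [constantCoeff_act, h0]

theorem reynolds_mul_of_mem {p : MvPolynomial (Fin n) ℂ} (hp : p ∈ invariants b W)
    (f : MvPolynomial (Fin n) ℂ) : reynolds b W (f * p) = reynolds b W f * p := by
  have := Fintype.ofFinite W
  rw [reynolds_apply, reynolds_apply, smul_mul_assoc, Finset.sum_mul]
  congr 1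
  exact Finset.sum_congr rfl fun w _ => by rw [map_mul, hp w.1 w.2]

theorem reynolds_eq_self {p : MvPolynomial (Fin n) ℂ} (hp : p ∈ invariants b W) :
    reynolds b W p = p := by
  have := Fintype.ofFinite W
  rw [reynolds_apply, Finset.sum_congr rfl fun w _ => hp w.1 w.2]
  rw [Finset.sum_const, Finset.card_univ, ← Nat.cast_smul_eq_nsmul ℂ, inv_smul_smul₀]
  exact Nat.cast_ne_zero.mpr Fintype.card_ne_zero

/-- Averaging is linear over the invariants, so `xⱼ q p` goes to the average of `xⱼ q` times `p`;
the factor `xⱼ` ensures that the first factor has no constant term. -/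
theorem reynolds_X_mul_mem_decomposables {i : MvPolynomial (Fin n) ℂ}
    (hi : i ∈ coinvariantIdeal b W) (j : Fin n) :
    reynolds b W (X j * i) ∈ decomposables b W := by
  refine coinvariantIdeal_induction b
    (P := fun i => reynolds b W (X j * i) ∈ decomposables b W)
    (fun q p hp h0 => ?_) ?_ (fun x y hx hy => ?_) hi
  · rw [← mul_assoc, reynolds_mul_of_mem b hp]
    exact Submodule.subset_span ⟨_, p, reynolds_mem_invariants b _,
      constantCoeff_reynolds b (by simp), hp, h0, rfl⟩
  · rw [mul_zero, map_zero]
    exact zero_mem _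
  · rw [mul_add, map_add]
    exact add_mem hx hy

end Reynolds

variable {W} {h : Fin n → MvPolynomial (Fin n) ℂ} {d : Fin n → ℕ}

theorem constantCoeff_eq_zero_of_isHomogeneous {p : MvPolynomial (Fin n) ℂ} {k : ℕ} (hk : 0 < k)
    (hp : p.IsHomogeneous k) : constantCoeff p = 0 := by
  rw [constantCoeff_eq]
  exact hp.coeff_eq_zero (by simpa using hk.ne)

theorem IsBasicInvariants.exists_aeval_eq (hh : IsBasicInvariants b W h)
    {p : MvPolynomial (Fin n) ℂ} (hp : p ∈ invariants b W) :
    ∃ P : MvPolynomial (Fin n) ℂ, aeval h P = p := by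
  rw [← hh.adjoin_eq, Algebra.adjoin_range_eq_range_aeval] at hp
  exact hp

theorem IsBasicInvariants.aeval_mem (hh : IsBasicInvariants b W h)
    (P : MvPolynomial (Fin n) ℂ) : aeval h P ∈ invariants b W := by
  rw [← hh.adjoin_eq, Algebra.adjoin_range_eq_range_aeval]
  exact ⟨P, rfl⟩

theorem IsBasicInvariants.mem (hh : IsBasicInvariants b W h) (i : Fin n) :
    h i ∈ invariants b W := by
  rw [← hh.adjoin_eq]
  exact Algebra.subset_adjoin ⟨i, rfl⟩

theorem IsBasicInvariants.degree_pos (hh : IsBasicInvariants b W h)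
    (hd : ∀ i, (h i).IsHomogeneous (d i)) (i : Fin n) : 0 < d i := by
  rw [Nat.pos_iff_ne_zero]
  intro h0
  have h1 := hd i
  rw [h0, ← totalDegree_zero_iff_isHomogeneous _, totalDegree_eq_zero_iff_eq_C] at h1
  have h2 := hh.algebraicIndependent.transcendental i
  rw [h1] at h2
  exact h2 (isAlgebraic_algebraMap (R := ℂ) (A := MvPolynomial (Fin n) ℂ) _)

theorem constantCoeff_aeval (hd0 : ∀ i, 0 < d i) (hd : ∀ i, (h i).IsHomogeneous (d i))
    (P : MvPolynomial (Fin n) ℂ) : constantCoeff (aeval h P) = constantCoeff P := by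
  induction P using MvPolynomial.induction_on with
  | C c => simp
  | add p q hp hq => simp only [map_add, hp, hq]
  | mul_X p i hp =>
    simp only [map_mul, aeval_X, constantCoeff_eq_zero_of_isHomogeneous (hd0 i) (hd i),
      constantCoeff_X, mul_zero]

/-- A decomposable invariant is a polynomial without constant and linear terms in the basic
invariants. -/
theorem exists_aeval_eq_of_mem_decomposables (hh : IsBasicInvariants b W h)
    (hd : ∀ i, (h i).IsHomogeneous (d i)) {x : MvPolynomial (Fin n) ℂ}
    (hx : x ∈ decomposables b W) :
    ∃ P : MvPolynomial (Fin n) ℂ, aeval h P = x ∧ ∀ m, coeff m P ≠ 0 → 2 ≤ m.degree := by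
  classical
  have hd0 := hh.degree_pos b hd
  induction hx using Submodule.span_induction with
  | mem x hx =>
    obtain ⟨p, q, hp, hp0, hq, hq0, rfl⟩ := hx
    obtain ⟨P, rfl⟩ := hh.exists_aeval_eq b hp
    obtain ⟨Q, rfl⟩ := hh.exists_aeval_eq b hq
    rw [constantCoeff_aeval hd0 hd] at hp0 hq0
    refine ⟨P * Q, map_mul _ _ _, fun m hm => ?_⟩
    rw [coeff_mul] at hm
    obtain ⟨⟨a, a'⟩, ha, hne⟩ := Finset.exists_ne_zero_of_sum_ne_zero hm
    rw [Finset.HasAntidiagonal.mem_antidiagonal] at ha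
    have h1 : a.degree ≠ 0 := fun h => left_ne_zero_of_mul hne (by
      rw [(Finsupp.degree_eq_zero_iff a).mp h]; exact hp0)
    have h2 : a'.degree ≠ 0 := fun h => right_ne_zero_of_mul hne (by
      rw [(Finsupp.degree_eq_zero_iff a').mp h]; exact hq0)
    change a + a' = m at ha
    rw [← ha, map_add]
    omega
  | zero => exact ⟨0, map_zero _, fun m hm => absurd (coeff_zero m) hm⟩
  | add x y _ _ hx hy =>
    obtain ⟨P, rfl, hP⟩ := hx
    obtain ⟨Q, rfl, hQ⟩ := hy
    refine ⟨P + Q, map_add _ _ _, fun m hm => ?_⟩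
    by_cases h1 : coeff m P = 0
    · exact hQ m fun h2 => hm (by rw [coeff_add, h1, h2, add_zero])
    · exact hP m h1
  | smul c x _ hx =>
    obtain ⟨P, rfl, hP⟩ := hx
    refine ⟨c • P, map_smul _ _ _, fun m hm => hP m fun h1 => hm ?_⟩
    rw [coeff_smul, h1, smul_zero]

/-- By algebraic independence an invariant is a unique polynomial in the `hᵢ`, so a linear one
cannot coincide with one having only terms of order at least two. -/
theorem eq_zero_of_sum_smul_mem_decomposables (hh : IsBasicInvariants b W h)
    (hd : ∀ i, (h i).IsHomogeneous (d i)) {c : Fin n → ℂ}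
    (hc : ∑ i, c i • h i ∈ decomposables b W) (i : Fin n) : c i = 0 := by
  classical
  obtain ⟨P, hP, hP2⟩ := exists_aeval_eq_of_mem_decomposables b hh hd hc
  have h1 : P = ∑ i, c i • X i := hh.algebraicIndependent (by
    rw [hP, map_sum]
    simp)
  have h2 : coeff (Finsupp.single i 1) P = c i := by
    rw [h1, coeff_sum, Finset.sum_eq_single i]
    · simp
    · intro j _ hj
      rw [coeff_smul, coeff_X, if_neg, smul_zero]
      intro h
      exact hj (Finsupp.single_left_injective one_ne_zero h)
    · simp
  by_contra hne
  have := hP2 (Finsupp.single i 1) (h2 ▸ hne)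
  rw [Finsupp.degree_single] at this
  omega

variable [Finite W] {L : Submodule ℂ V → Module.Dual ℂ V}
  (hL : ∀ H ∈ reflectingHyperplanes W, LinearMap.ker (L H) = H)
include hL

theorem linearIndependent_canonicalPoly (hW : IsReflectionGroup W) (hh : IsBasicInvariants b W h) :
    LinearIndependent ℂ fun i => canonicalPoly (discriminantForm b W L) (h i) := by
  choose d hd using hh.homogeneous
  have hd0 := hh.degree_pos b hd
  rw [Fintype.linearIndependent_iff]
  intro c hc i
  rw [← canonicalPoly_sum_smul] at hc
  have h1 : ∀ j, pderiv j (∑ i, c i • h i) ∈ coinvariantIdeal b W := fun j =>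
    mem_coinvariantIdeal_of_starOp_eq_zero b hL hW
      (starOp_pderiv_eq_zero_of_canonicalPoly_eq_zero hc j)
  have h2 : ∑ j, X j * pderiv j (∑ i, c i • h i) = ∑ i, (c i * d i) • h i := by
    simp only [map_sum, Finset.mul_sum]
    rw [Finset.sum_comm]
    refine Finset.sum_congr rfl fun i _ => ?_
    simp only [Derivation.map_smul, mul_smul_comm]
    rw [← Finset.smul_sum, (hd i).sum_X_mul_pderiv, mul_smul, Nat.cast_smul_eq_nsmul]
  -- The Euler sum is invariant, hence equal to its average, and every term `xⱼ ∂ⱼ h` has `∂ⱼ h` in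
  -- the coinvariant ideal.
  have h3 : ∑ i, (c i * d i) • h i ∈ decomposables b W := by
    have hinv : ∑ i, (c i * d i) • h i ∈ invariants b W :=
      Subalgebra.sum_mem _ fun i _ => Subalgebra.smul_mem _ (hh.mem b i) _
    rw [← reynolds_eq_self b hinv, ← h2, map_sum]
    exact Submodule.sum_mem _ fun j _ => reynolds_X_mul_mem_decomposables b (h1 j) j
  have h4 := eq_zero_of_sum_smul_mem_decomposables b hh hd h3 i
  exact (mul_eq_zero.mp h4).resolve_right (Nat.cast_ne_zero.mpr (hd0 i).ne')

end Decomposable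

/-! ### Gram–Schmidt orthonormalization -/

section GramSchmidt

variable {n : ℕ}

theorem pairing_gramSchmidtPoly {g : Fin n → MvPolynomial (Fin n) ℂ} (hg : LinearIndependent ℂ g)
    (i j : Fin n) :
    pairing (gramSchmidtPoly g i) (gramSchmidtPoly g j) = if i = j then 1 else 0 := by
  let _ : NormedAddCommGroup (MvPolynomial (Fin n) ℂ) := (pairingCore n).toNormedAddCommGroup
  let _ : InnerProductSpace ℂ (MvPolynomial (Fin n) ℂ) := InnerProductSpace.ofCore
    (pairingCore n).toCore
  exact orthonormal_iff_ite.mp (InnerProductSpace.gramSchmidtNormed_orthonormal hg) i j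

theorem gramSchmidtPoly_mem_span (g : Fin n → MvPolynomial (Fin n) ℂ) (i : Fin n) :
    gramSchmidtPoly g i ∈ Submodule.span ℂ (Set.range g) := by
  let _ : NormedAddCommGroup (MvPolynomial (Fin n) ℂ) := (pairingCore n).toNormedAddCommGroup
  let _ : InnerProductSpace ℂ (MvPolynomial (Fin n) ℂ) := InnerProductSpace.ofCore
    (pairingCore n).toCore
  rw [← InnerProductSpace.span_gramSchmidt ℂ g,
    ← InnerProductSpace.span_gramSchmidtNormed_range g]
  exact Submodule.subset_span ⟨i, rfl⟩

theorem isHomogeneous_gramSchmidtPoly {g : Fin n → MvPolynomial (Fin n) ℂ} {d : Fin n → ℕ}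
    (hg : ∀ i, (g i).IsHomogeneous (d i)) (i : Fin n) :
    (gramSchmidtPoly g i).IsHomogeneous (d i) := by
  let _ : NormedAddCommGroup (MvPolynomial (Fin n) ℂ) := (pairingCore n).toNormedAddCommGroup
  let _ : InnerProductSpace ℂ (MvPolynomial (Fin n) ℂ) := InnerProductSpace.ofCore
    (pairingCore n).toCore
  have key : ∀ i, InnerProductSpace.gramSchmidt ℂ g i ∈ homogeneousSubmodule (Fin n) ℂ (d i) := by
    intro i
    induction i using WellFoundedLT.induction with
    | ind i ih =>
      rw [eq_sub_of_add_eq (InnerProductSpace.gramSchmidt_def'' ℂ g i).symm]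
      refine Submodule.sub_mem _ (hg i) (Submodule.sum_mem _ fun j hj => ?_)
      have hj' := ih j (Finset.mem_Iio.mp hj)
      -- The degrees need not be sorted: distinct degrees are orthogonal, so only earlier vectors of
      -- the same degree are subtracted.
      by_cases hij : d j = d i
      · exact Submodule.smul_mem _ _ (hij ▸ hj')
      · have h0 : inner ℂ (InnerProductSpace.gramSchmidt ℂ g j) (g i) = 0 :=
          pairing_eq_zero_of_degree_ne hij hj' (hg i)
        rw [h0, zero_div, zero_smul]
        exact zero_mem _
  exact Submodule.smul_mem (homogeneousSubmodule (Fin n) ℂ (d i)) _ (key i)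

end GramSchmidt

/-! ### Characterization of canonical systems -/

/-- The kernels of the powers of `φ` stabilize; an element of `ker φ` is some `φ^k y`, so `y ∈ ker
φ^(k+1) = ker φ^k`. It is used to turn `n` generators of `R` into algebraically independent ones. -/
theorem injective_of_surjective_of_isNoetherianRing {R : Type*} [CommRing R] [IsNoetherianRing R]
    (φ : R →+* R) (hφ : Function.Surjective φ) : Function.Injective φ := by
  have hmono : Monotone fun k => RingHom.ker (φ ^ k) :=
    monotone_nat_of_le_succ fun k x hx => by
      rw [RingHom.mem_ker] at hx ⊢
      rw [pow_succ', RingHom.mul_def, RingHom.comp_apply, hx, map_zero]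
  obtain ⟨k, hk⟩ := monotone_stabilizes_iff_noetherian.mpr ‹IsNoetherianRing R›
    ⟨fun k => RingHom.ker (φ ^ k), hmono⟩
  rw [injective_iff_map_eq_zero]
  intro x hx
  have hsurj : Function.Surjective (φ ^ k) := by
    rw [RingHom.coe_pow]
    exact hφ.iterate k
  obtain ⟨y, rfl⟩ := hsurj x
  have h1 : y ∈ RingHom.ker (φ ^ (k + 1)) := by
    rw [RingHom.mem_ker, pow_succ', RingHom.mul_def, RingHom.comp_apply, hx]
  have h2 := hk (k + 1) (Nat.le_succ k)
  change RingHom.ker (φ ^ k) = RingHom.ker (φ ^ (k + 1)) at h2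
  rwa [← h2, RingHom.mem_ker] at h1

section Characterization

variable {n : ℕ} {V : Type*} [NormedAddCommGroup V] [InnerProductSpace ℂ V]
  (b : OrthonormalBasis (Fin n) ℂ V) {W : Subgroup (V ≃ₗᵢ[ℂ] V)}
  {h f : Fin n → MvPolynomial (Fin n) ℂ} {d : Fin n → ℕ}

theorem exists_eq_single_add_of_two_le_degree {m : Fin n →₀ ℕ} (hm : 2 ≤ m.degree) {k : Fin n}
    (hk : m k ≠ 0) : ∃ m' : Fin n →₀ ℕ, m = Finsupp.single k 1 + m' ∧ m' ≠ 0 := by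
  have h1 : Finsupp.single k 1 + (m - Finsupp.single k 1) = m := by
    rw [add_tsub_cancel_of_le]
    rw [Finsupp.single_le_iff]
    omega
  refine ⟨m - Finsupp.single k 1, h1.symm, fun h0 => ?_⟩
  rw [← h1, h0, add_zero, Finsupp.degree_single] at hm
  omega

theorem exists_ne_zero_of_two_le_degree {m : Fin n →₀ ℕ} (hm : 2 ≤ m.degree) : ∃ k, m k ≠ 0 := by
  by_contra! h0
  have : m = 0 := Finsupp.ext h0
  rw [this, map_zero] at hm
  omega

/-- A polynomial mapped to constants by the basic invariants is orthogonal to the decomposable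
invariants. -/
theorem pairing_aeval_eq_zero (hd0 : ∀ i, 0 < d i) (hd : ∀ i, (h i).IsHomogeneous (d i))
    {F : MvPolynomial (Fin n) ℂ} (hF : ∀ i, ∃ c, starOp (h i) F = C c)
    {Q : MvPolynomial (Fin n) ℂ} (hQ : ∀ m, coeff m Q ≠ 0 → 2 ≤ m.degree) :
    pairing (aeval h Q) F = 0 := by
  have key : ∀ m ∈ Q.support, pairing (aeval h (monomial m (coeff m Q))) F = 0 := by
    intro m hm
    have h2 := hQ m (mem_support_iff.mp hm)
    obtain ⟨k, hk⟩ := exists_ne_zero_of_two_le_degree h2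
    obtain ⟨m', hm', hne⟩ := exists_eq_single_add_of_two_le_degree h2 hk
    have h3 : monomial m (coeff m Q) = X k * monomial m' (coeff m Q) := by
      rw [X, monomial_mul, one_mul, ← hm']
    -- Moving one factor `h_k` across the pairing turns `F` into a constant, and the remaining
    -- nonempty product of the `hᵢ` vanishes at the origin.
    obtain ⟨c, hc⟩ := hF k
    rw [h3, map_mul, aeval_X, pairing_mul_left, hc, ← pairing_conj_symm, pairing, starOp_C,
      LinearMap.smul_apply, Module.End.one_apply, smul_eval,
      show eval (0 : Fin n → ℂ) = constantCoeff from eval_zero, constantCoeff_aeval hd0 hd,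
      constantCoeff_eq, coeff_monomial, if_neg hne, mul_zero, map_zero]
  rw [← pairing_conj_symm]
  conv_lhs => rw [Q.as_sum]
  rw [map_sum, pairing_sum_right, Finset.sum_eq_zero fun m hm => ?_, map_zero]
  rw [← pairing_conj_symm, key m hm, map_zero]

/-- Let `T` send `c` to the linear part of `∑ cⱼ fⱼ` as a polynomial in the `hᵢ`. If it vanishes, `∑
cⱼ fⱼ` is orthogonal to every `fⱼ`, hence to itself, so `c = 0`. Thus `T` is bijective, and the
linear part `hᵢ` can be matched. -/
theorem exists_eq_sum_add_aeval (hh : IsBasicInvariants b W h) (hd0 : ∀ i, 0 < d i)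
    (hd : ∀ i, (h i).IsHomogeneous (d i)) (hfd : ∀ i, (f i).IsHomogeneous (d i))
    (hf : ∀ i, f i ∈ invariants b W)
    (hlin : LinearIndependent ℂ f) (hconst : ∀ i j, ∃ c, starOp (h i) (f j) = C c) (i : Fin n) :
    ∃ (c : Fin n → ℂ) (Q : MvPolynomial (Fin n) ℂ), (∀ m, coeff m Q ≠ 0 → 2 ≤ m.degree) ∧
      h i = ∑ j, c j • f j + aeval h Q := by
  classical
  choose P hP using fun j => hh.exists_aeval_eq b (hf j)
  have hP0 : ∀ j, coeff 0 (P j) = 0 := fun j => by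
    rw [← constantCoeff_eq, ← constantCoeff_aeval hd0 hd, hP,
      constantCoeff_eq_zero_of_isHomogeneous (hd0 j) (hfd j)]
  let T : (Fin n → ℂ) →ₗ[ℂ] (Fin n → ℂ) :=
    { toFun := fun c k => coeff (Finsupp.single k 1) (∑ j, c j • P j)
      map_add' := fun c c' => by
        ext k
        simp [add_smul, Finset.sum_add_distrib]
      map_smul' := fun a c => by
        ext k
        simp [mul_smul, ← Finset.smul_sum] }
  have hord : ∀ R : MvPolynomial (Fin n) ℂ, coeff 0 R = 0 →
      (∀ k, coeff (Finsupp.single k 1) R = 0) → ∀ m, coeff m R ≠ 0 → 2 ≤ m.degree := by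
    intro R h0 h1 m hm
    by_contra! hlt
    have hcases : m.degree = 0 ∨ m.degree = 1 := by omega
    rcases hcases with h2 | h2
    · rw [(Finsupp.degree_eq_zero_iff m).mp h2] at hm
      exact hm h0
    · obtain ⟨k, hk⟩ : m ∈ Set.range fun k : Fin n => Finsupp.single k 1 := by
        rw [Finsupp.range_single_one]
        exact h2
      exact hm (hk ▸ h1 k)
  have hinj : Function.Injective T := by
    rw [injective_iff_map_eq_zero]
    intro c hc
    have h1 := hord (∑ j, c j • P j) (by simp [coeff_sum, hP0]) fun k => congrFun hc k
    have h2 : aeval h (∑ j, c j • P j) = ∑ j, c j • f j := by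
      simp only [map_sum, map_smul, hP]
    have h3 : ∑ j, c j • f j = 0 := by
      refine pairing_self_eq_zero ?_
      rw [pairing_sum_right]
      refine Finset.sum_eq_zero fun j _ => ?_
      have := pairing_aeval_eq_zero hd0 hd (fun i => hconst i j) h1
      rw [h2] at this
      rw [pairing, map_smul, smul_eval]
      exact mul_eq_zero_of_right _ this
    funext j
    exact Fintype.linearIndependent_iff.mp hlin c h3 j
  obtain ⟨c, hc⟩ := (LinearMap.injective_iff_surjective.mp hinj) (Pi.single i 1)
  refine ⟨c, X i - ∑ j, c j • P j, hord _ ?_ fun k => ?_, ?_⟩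
  · simp [coeff_sum, hP0]
  · have h1 : coeff (Finsupp.single k 1) (∑ j, c j • P j) = _ := congrFun hc k
    rw [coeff_sub, h1, coeff_X, Pi.single_apply, sub_eq_zero]
    simp only [Finsupp.single_left_inj one_ne_zero, eq_comm]
  · simp only [map_sub, map_sum, map_smul, hP, aeval_X, add_sub_cancel]

theorem isHomogeneous_aeval_monomial (hd : ∀ i, (h i).IsHomogeneous (d i)) (m : Fin n →₀ ℕ) :
    (aeval h (monomial m (1 : ℂ))).IsHomogeneous (∑ k, m k * d k) := by
  rw [aeval_monomial, map_one, one_mul, Finsupp.prod_fintype _ _ fun _ => pow_zero _]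
  refine IsHomogeneous.prod _ _ _ fun k _ => ?_
  rw [mul_comm]
  exact (hd k).pow _

theorem homogeneousComponent_mem_of_isHomogeneous {A : Subalgebra ℂ (MvPolynomial (Fin n) ℂ)}
    {p : MvPolynomial (Fin n) ℂ} {k m : ℕ} (hp : p.IsHomogeneous k) (h : k = m → p ∈ A) :
    homogeneousComponent m p ∈ A := by
  rw [homogeneousComponent_of_mem hp]
  split_ifs with hkm
  · exact h hkm.symm
  · exact zero_mem _

theorem isBasicInvariants_of_starOp_eq_C (hh : IsBasicInvariants b W h)
    (hd : ∀ i, (h i).IsHomogeneous (d i)) (hfd : ∀ i, (f i).IsHomogeneous (d i))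
    (hf : ∀ i, f i ∈ invariants b W) (hlin : LinearIndependent ℂ f)
    (hconst : ∀ i j, ∃ c, starOp (h i) (f j) = C c) : IsBasicInvariants b W f := by
  have hd0 := hh.degree_pos b hd
  have hmem : ∀ m, ∀ i, d i = m → h i ∈ Algebra.adjoin ℂ (Set.range f) := by
    intro m
    induction m using Nat.strong_induction_on with
    | _ m ih =>
      intro i hi
      obtain ⟨c, Q, hQ, hcQ⟩ := exists_eq_sum_add_aeval b hh hd0 hd hfd hf hlin hconst i
      have h1 : homogeneousComponent m (h i) = h i := by
        rw [homogeneousComponent_of_mem (hd i), if_pos hi.symm]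
      -- In degree `m`, every surviving monomial of `Q` has at least two factors of positive degree,
      -- so each `h_k` in it has degree below `m` and induction applies.
      rw [← h1, hcQ, map_add, map_sum]
      refine add_mem (sum_mem fun j _ => ?_) ?_
      · rw [map_smul]
        exact Subalgebra.smul_mem _ (homogeneousComponent_mem_of_isHomogeneous (hfd j) fun _ =>
          Algebra.subset_adjoin (Set.mem_range_self j)) _
      · conv => rw [Q.as_sum]
        rw [map_sum, map_sum]
        refine sum_mem fun a ha => ?_
        rw [← mul_one (coeff a Q), ← smul_eq_mul, ← smul_monomial, map_smul, map_smul]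
        refine Subalgebra.smul_mem _ (homogeneousComponent_mem_of_isHomogeneous
          (isHomogeneous_aeval_monomial hd a) fun hwt => ?_) _
        rw [aeval_monomial, map_one, one_mul]
        refine Subalgebra.prod_mem _ fun k hk => Subalgebra.pow_mem _ (ih (d k) ?_ k rfl) _
        obtain ⟨a', rfl, hne⟩ := exists_eq_single_add_of_two_le_degree
          (hQ a (mem_support_iff.mp ha)) (Finsupp.mem_support_iff.mp hk)
        obtain ⟨l, hl⟩ := Finsupp.ne_iff.mp hne
        have h2 : a' l * d l ≤ ∑ k, a' k * d k :=
          Finset.single_le_sum (f := fun k => a' k * d k) (fun _ _ => Nat.zero_le _)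
            (Finset.mem_univ l)
        have h3 : 0 < a' l * d l := Nat.mul_pos (Nat.pos_of_ne_zero hl) (hd0 l)
        simp only [Finsupp.add_apply, add_mul, Finset.sum_add_distrib] at hwt
        rw [Finset.sum_eq_single k (by intro j _ hj; simp [hj.symm]) (by simp)] at hwt
        simp only [Finsupp.single_eq_same, one_mul] at hwt
        omega
  have hadj : Algebra.adjoin ℂ (Set.range f) = invariants b W := by
    refine le_antisymm (Algebra.adjoin_le ?_) ?_
    · rintro _ ⟨i, rfl⟩
      exact hf i
    · rw [← hh.adjoin_eq]
      refine Algebra.adjoin_le ?_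
      rintro _ ⟨i, rfl⟩
      exact hmem _ i rfl
  refine ⟨fun i => ⟨d i, hfd i⟩, ?_, hadj⟩
  choose P hP using fun j => hh.exists_aeval_eq b (hf j)
  have hcomp : ∀ p, aeval f p = aeval h (aeval P p) := fun p => by
    rw [← AlgHom.comp_apply, comp_aeval]
    simp only [hP]
  -- With `fⱼ = Pⱼ(h)`, the fact that the `fⱼ` generate `R` says exactly that `xⱼ ↦ Pⱼ` is onto; its
  -- injectivity is the algebraic independence of the `fⱼ`.
  have hsurj : Function.Surjective (aeval P : MvPolynomial (Fin n) ℂ →ₐ[ℂ] _) := by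
    intro y
    have h1 := hh.aeval_mem b y
    rw [← hadj, Algebra.adjoin_range_eq_range_aeval] at h1
    obtain ⟨x, hx⟩ := h1
    refine ⟨x, hh.algebraicIndependent ?_⟩
    rw [← hcomp]
    exact hx
  have hinj := injective_of_surjective_of_isNoetherianRing
    (aeval P : MvPolynomial (Fin n) ℂ →ₐ[ℂ] MvPolynomial (Fin n) ℂ).toRingHom hsurj
  intro x y hxy
  rw [hcomp, hcomp] at hxy
  exact hinj (hh.algebraicIndependent hxy)

end Characterization

end

end CanonicalInvariants

/-! ### The main theorem. -/

theorem mainTheorem3 {n : ℕ} {V : Type*} [NormedAddCommGroup V] [InnerProductSpace ℂ V]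
    (b : OrthonormalBasis (Fin n) ℂ V)
    (W : Subgroup (V ≃ₗᵢ[ℂ] V)) [Finite W] (hW : CanonicalInvariants.IsReflectionGroup W)
    (L : Submodule ℂ V → Module.Dual ℂ V)
    (hL : ∀ H ∈ CanonicalInvariants.reflectingHyperplanes W, LinearMap.ker (L H) = H)
    (h : Fin n → MvPolynomial (Fin n) ℂ)
    (hh : CanonicalInvariants.IsBasicInvariants b W h) :
    CanonicalInvariants.IsCanonicalSystem b W
      (CanonicalInvariants.gramSchmidtPoly fun i =>
        ∑ j, MvPolynomial.X j *
          CanonicalInvariants.phi (CanonicalInvariants.discriminantForm b W L)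
            (MvPolynomial.pderiv j (h i))) := by
  open CanonicalInvariants MvPolynomial in
  let Δ := discriminantForm b W L
  let g : Fin n → MvPolynomial (Fin n) ℂ := fun i => canonicalPoly Δ (h i)
  change IsCanonicalSystem b W (gramSchmidtPoly g)
  obtain ⟨d, hd⟩ := Classical.axiomOfChoice hh.homogeneous
  have hd0 := hh.degree_pos b hd
  have hglin : LinearIndependent ℂ g := linearIndependent_canonicalPoly b hL hW hh
  have hpair := pairing_gramSchmidtPoly hglin
  have hfd : ∀ i, (gramSchmidtPoly g i).IsHomogeneous (d i) :=
    isHomogeneous_gramSchmidtPoly fun i =>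
      isHomogeneous_canonicalPoly (isHomogeneous_discriminantForm b) (hd0 i) (hd i)
  have hf : ∀ i, gramSchmidtPoly g i ∈ invariants b W := fun i => by
    refine (Submodule.span_le (p := Subalgebra.toSubmodule (invariants b W))).mpr ?_
      (gramSchmidtPoly_mem_span g i)
    rintro _ ⟨j, rfl⟩
    exact canonicalPoly_mem_invariants b hL (hh.mem b j)
  -- Needed for two choices of `p`: the given `hᵢ`, to obtain basic invariants, and the
  -- orthonormalized polynomials themselves, to obtain canonicity.
  have hconst : ∀ p ∈ invariants b W, ∀ k, 0 < k → p.IsHomogeneous k →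
      ∀ j, ∃ c, starOp p (gramSchmidtPoly g j) = C c := by
    intro p hp k hk hpk j
    have h1 := gramSchmidtPoly_mem_span g j
    generalize gramSchmidtPoly g j = F at h1 ⊢
    induction h1 using Submodule.span_induction with
    | mem x hx =>
      obtain ⟨i, rfl⟩ := hx
      exact starOp_canonicalPoly_eq_C b hL hp (hh.mem b i) hk (hd0 i) hpk (hd i)
    | zero => exact ⟨0, by rw [map_zero, C_0]⟩
    | add x y _ _ hx hy =>
      obtain ⟨c, hc⟩ := hx
      obtain ⟨e, he⟩ := hy
      exact ⟨c + e, by rw [map_add, hc, he, C_add]⟩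
    | smul a x _ hx =>
      obtain ⟨c, hc⟩ := hx
      exact ⟨a * c, by rw [map_smul, hc, smul_eq_C_mul, C_mul]⟩
  have hlin : LinearIndependent ℂ (gramSchmidtPoly g) := by
    rw [Fintype.linearIndependent_iff]
    intro c hc i
    have h1 : pairing (gramSchmidtPoly g i) (∑ j, c j • gramSchmidtPoly g j) = c i := by
      rw [pairing_sum_right, Finset.sum_eq_single i]
      · have := hpair i i
        rw [pairing] at this ⊢
        rw [map_smul, smul_eval, this, if_pos rfl, mul_one]
      · intro j _ hj
        have := hpair i j
        rw [pairing] at this ⊢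
        rw [map_smul, smul_eval, this, if_neg hj.symm, mul_zero]
      · simp
    rw [← h1, hc, pairing, map_zero, map_zero]
  refine ⟨isBasicInvariants_of_starOp_eq_C b hh hd hfd hf hlin fun i j =>
    hconst (h i) (hh.mem b i) (d i) (hd0 i) (hd i) j, fun i j => ?_⟩
  -- A constant equals its value at the origin, which here is the pairing.
  obtain ⟨c, hc⟩ := hconst _ (hf i) (d i) (hd0 i) (hfd i) j
  have h1 := hpair i j
  rw [pairing, hc, eval_C] at h1
  rw [hc, h1]
  split_ifs <;> simp
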